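/- **Setting.** Let $N$ be a lattice (a free $\mathbb Z$-module of finite rank with a symmetric integral bilinear form $(x,y)\mapsto x.y$) that is non-degenerate of signature $(2,\rho)$, and let $$\mathfrak D(N)=\{[z]\in\mathbb P(N_{\mathbb C}) \mid z.z=0,\ z.\bar z>0\}\cong O(2,\rho)/(SO(2)\times O(\rho)).$$ Let $\mathfrak g=\mathfrak{so}(N_{\mathbb R})$. For $[z]\in\mathfrak D(N)$ let $P=\mathbb R\langle \mathrm{Re}\,z,\mathrm{Im}\,z\rangle$ and $\mathfrak m_P=\{X\in\mathfrak g\mid X(P)\subset P^\perp,\ X(P^\perp)\subset P\}$. The infinitesimal action identifies $\mathfrak m_P$ with $T_{[z]}\mathfrak D(N)$, and $\mathfrak D(N)$ carries the $O(N_{\mathbb R})$-invariant Riemannian metric given on $\mathfrak m_P$ by the Killing form of $\mathfrak g$. A *geodesic of constant speed* $k$ is a smooth curve of constant speed $k$ that is locally length-minimizing. For a primitive isotropic vector $v\in N$ the tube domain $T(N,v)$ is the set of all $x+iy$ with $x,y\in N_{\mathbb R}/\mathbb R v$, $x.v=-1$, $y.v=0$, $y.y>0$; and $\exp_v(x+iy)\in\mathfrak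 D(N)$ is the class $[z]$ of the unique $z\in N_{\mathbb C}$ with $z.z=0$ that lies over $x+iy\in N_{\mathbb C}/\mathbb C v$. Let $\mathfrak D^+$ be a connected component of $\mathfrak D(N)$ and $\Gamma$ a group of isometries of $N$ that preserve $\mathfrak D^+$. Geodesics in $\Gamma\backslash\mathfrak D^+$ are by definition the images of geodesics in $\mathfrak D^+$. A vector $v\in N$ is *standard* if $v.v=0$ and $\gcd\{v.w\mid w\in N\}=1$. A path $\gamma(t)\in\Gamma\backslash\mathfrak D^+$, $t\gg0$, is a *linear degeneration* to the cusp $[v]=\Gamma\cdot v$ of a standard vector $v$ if there are $w\in\Gamma\cdot v$ and $x_0+iy_0\in T(N,w)$ such that, for $t\gg 0$, $\exp_w(x_0+i\,t\,y_0)$ lies in $\mathfrak D^+$ and is a lift of $\gamma(t)$. For a projective K3 surface $X$ let $\tilde H(X,\mathbb Z)=H^0\oplus H^2\oplus H^4$ with the Mukai pairing $(r,l,s).(r',l',s')=l.l'-rs'-r's$ and the weight-two Hodge structure with $\tilde H^{2,0}=H^{2,0}(X)$. Let $N(X)=H^0\oplus NS(X)\oplus H^4$, a lattice of signature $(2,\rho(X))$,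 let $v_0=(0,0,1)$, let $\mathfrak D^+(X)$ be the component of $\mathfrak D(N(X))$ that contains $\exp_{v_0}(ih)$ for $h\in NS(X)$ ample, and let $\Gamma_X^+\subset O(N(X))$ be the image of the group of Hodge isometries of $\tilde H(X,\mathbb Z)$ that preserve $\mathfrak D^+(X)$. The Kähler moduli space is $KM(X)=\Gamma_X^+\backslash\mathfrak D^+(X)$. **Statement.** 1. For every primitive isotropic $v\in N$ and every $x+iy\in T(N,v)$, the path $\alpha(t)=\exp_v(x+i\,e^t\,y)$, $t\in\mathbb R$, is a geodesic of $\mathfrak D(N)$ of constant positive speed. 2. For all $N$, $\mathfrak D^+$, $\Gamma$ as above, every linear degeneration $\gamma(t)$ to the cusp of a standard vector is a geodesic in $\Gamma\backslash\mathfrak D^+$: for $s\gg 0$ the path $s\mapsto\gamma(e^s)$ is the image of a geodesic in $\mathfrak D^+$ of constant positive speed. 3. In particular, for every projective K3 surface $X$, linear degenerations to standard cusps are geodesics in the Kähler moduli space $KM(X)$, again with constant positive speed in the parameter $s=\log t$. -/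

import Mathlib

open scoped TensorProduct ContDiff ENNReal LinearAlgebra.Projectivization

universe u

noncomputable section

namespace KahlerPeriod

/-! ## Complexified quadratic spaces and the period domain -/

section RealSpace

variable {V : Type u} [AddCommGroup V] [Module ℝ V]

/-- The complexification `V_ℂ` of a real vector space `V`. -/
abbrev Cx (V : Type u) [AddCommGroup V] [Module ℝ V] : Type u := ℂ ⊗[ℝ] V

/-- The vector `x + i y` of `V_ℂ`. -/
def ofReIm (x y : V) : Cx V := (1 : ℂ) ⊗ₜ[ℝ] x + Complex.I ⊗ₜ[ℝ] y

/-- The real part `V_ℂ → V`. -/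
def rePart : Cx V →ₗ[ℝ] V :=
  (TensorProduct.lid ℝ V).toLinearMap ∘ₗ LinearMap.rTensor V Complex.reLm

/-- The imaginary part `V_ℂ → V`. -/
def imPart : Cx V →ₗ[ℝ] V :=
  (TensorProduct.lid ℝ V).toLinearMap ∘ₗ LinearMap.rTensor V Complex.imLm

/-- Complex conjugation on `V_ℂ`. -/
def conjCx : Cx V →ₗ[ℝ] Cx V := LinearMap.rTensor V Complex.conjAe.toLinearMap

/-- The `ℂ`-bilinear extension of a real bilinear form. -/
def cform (B : LinearMap.BilinForm ℝ V) : LinearMap.BilinForm ℂ (Cx V) :=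
  LinearMap.BilinForm.baseChange ℂ B

/-- `B` is a non-degenerate symmetric form of signature `(p, q)`. -/
def HasSignature (B : LinearMap.BilinForm ℝ V) (p q : ℕ) : Prop :=
  B.IsSymm ∧ B.Nondegenerate ∧ sigPos (LinearMap.BilinMap.toQuadraticMap B) = p ∧
    sigNeg (LinearMap.BilinMap.toQuadraticMap B) = q

/-- The cone of all `z ∈ V_ℂ` with `z.z = 0` and `z.z̄ > 0`. -/
def periodCone (B : LinearMap.BilinForm ℝ V) : Set (Cx V) :=
  {z | cform B z z = 0 ∧ 0 < (cform B z (conjCx z)).re}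

/-- The period domain `{[z] ∈ ℙ(V_ℂ) | z.z = 0, z.z̄ > 0}`. -/
def periodDomain (B : LinearMap.BilinForm ℝ V) : Set (ℙ ℂ (Cx V)) :=
  {p | p.rep ∈ periodCone B}

/-- `z` is a non-zero vector with `[z] = p`. -/
def Represents (p : ℙ ℂ (Cx V)) (z : Cx V) : Prop :=
  ∃ h : z ≠ 0, Projectivization.mk ℂ z h = p

/-! ## Curves in finite-dimensional real vector spaces

Regularity is tested on all linear coordinates, so that no norm has to be chosen. -/

/-- The curve `f` is of class `C^n` on `s`. -/
def CurveContDiffOn {W : Type u} [AddCommGroup W] [Module ℝ W] (n : WithTop ℕ∞) (f : ℝ → W)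
    (s : Set ℝ) : Prop :=
  ∀ φ : Module.Dual ℝ W, ContDiffOn ℝ n (fun t => φ (f t)) s

/-- The curve `f` is continuous on `s`. -/
def CurveContinuousOn {W : Type u} [AddCommGroup W] [Module ℝ W] (f : ℝ → W)
    (s : Set ℝ) : Prop :=
  ∀ φ : Module.Dual ℝ W, ContinuousOn (fun t => φ (f t)) s

/-- The curve `f`, restricted to `s`, has derivative `w` at `t`. -/
def CurveHasDerivWithinAt {W : Type u} [AddCommGroup W] [Module ℝ W] (f : ℝ → W) (w : W)
    (s : Set ℝ) (t : ℝ) : Prop :=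
  ∀ φ : Module.Dual ℝ W, HasDerivWithinAt (fun r => φ (f r)) (φ w) s t

/-! ## The invariant Riemannian metric -/

attribute [local instance 100] LieRing.ofAssociativeRing

/-- The Lie algebra `𝔤 = 𝔰𝔬(V, B)` of the orthogonal group of `(V, B)`. -/
abbrev soLie (B : LinearMap.BilinForm ℝ V) : LieSubalgebra ℝ (Module.End ℝ V) :=
  skewAdjointLieSubalgebra B

/-- The real plane `P` spanned by the real and imaginary parts of `z`. -/
def periodPlane (z : Cx V) : Submodule ℝ V := Submodule.span ℝ {rePart z, imPart z}

/-- The complement `𝔪_P = {X ∈ 𝔤 | X(P) ⊆ P^⊥, X(P^⊥) ⊆ P}` of the Lie algebra `𝔨_P` of the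
stabilizer of `[z]` in the Cartan decomposition `𝔤 = 𝔨_P ⊕ 𝔪_P`. -/
def cartanComplement (B : LinearMap.BilinForm ℝ V) (z : Cx V) : Set (soLie B) :=
  {X | (∀ p ∈ periodPlane z, X.1 p ∈ B.orthogonal (periodPlane z)) ∧
    ∀ q ∈ B.orthogonal (periodPlane z), X.1 q ∈ periodPlane z}

/-- The tangent space of `ℙ(V_ℂ)` at `[z]` is `Hom(ℂ z, V_ℂ / ℂ z)`; a curve `[ζ(t)]` has there the
tangent vector `ζ ↦ ζ'` modulo `ζ`. The element `X` of `𝔤` induces the tangent vector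
`d/dt exp(t X)[z]`, that is `z ↦ X z`. This says that these two agree, for `z = ζ(t)`,
`ξ = ζ'(t)`. -/
def InducesTangent (B : LinearMap.BilinForm ℝ V) (X : soLie B) (z ξ : Cx V) : Prop :=
  LinearMap.baseChange ℂ X.1 z - ξ ∈ Submodule.span ℂ {z}

/-- The Riemannian norm of the tangent vector `ξ` modulo `z` at `[z]`: it is `√(K(X, X))`, where `K`
is the Killing form of `𝔤` and `X` is the element of `𝔪_P` which induces the tangent vector. (At
points of the period domain and for vectors tangent to it there is exactly one such `X`, so the
infimum is over one element.) -/
def tangentNorm (B : LinearMap.BilinForm ℝ V) (z ξ : Cx V) : ℝ≥0∞ :=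
  ⨅ X ∈ {X : soLie B | X ∈ cartanComplement B z ∧ InducesTangent B X z ξ},
    ENNReal.ofReal (Real.sqrt (killingForm ℝ (soLie B) X X))

/-- A `C¹` path `[0,1] → periodDomain B` from `p` to `q`, given by a `C¹` lift `ζ` to `V_ℂ` with
derivative `ζ'`. -/
structure C1Path (B : LinearMap.BilinForm ℝ V) (p q : ℙ ℂ (Cx V)) where
  ζ : ℝ → Cx V
  ζ' : ℝ → Cx V
  contDiff : CurveContDiffOn 1 ζ (Set.Icc 0 1)
  deriv : ∀ t ∈ Set.Icc (0 : ℝ) 1, CurveHasDerivWithinAt ζ (ζ' t) (Set.Icc 0 1) t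
  mem : ∀ t ∈ Set.Icc (0 : ℝ) 1, ζ t ∈ periodCone B
  source : Represents p (ζ 0)
  target : Represents q (ζ 1)

/-- The Riemannian length of a `C¹` path. -/
def C1Path.length {B : LinearMap.BilinForm ℝ V} {p q : ℙ ℂ (Cx V)} (γ : C1Path B p q) : ℝ≥0∞ :=
  ∫⁻ t in Set.Icc (0 : ℝ) 1, tangentNorm B (γ.ζ t) (γ.ζ' t)

/-- The Riemannian distance on the period domain: the infimum of the lengths of `C¹` paths. -/
def riemannianDist (B : LinearMap.BilinForm ℝ V) (p q : ℙ ℂ (Cx V)) : ℝ≥0∞ :=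
  ⨅ γ : C1Path B p q, γ.length

/-- `c` is, on the open interval `s`, a geodesic of the period domain of constant speed `k`: it is a
smooth curve in the period domain with speed `k`, and it is locally length-minimizing. -/
structure IsGeodesicOn (B : LinearMap.BilinForm ℝ V) (c : ℝ → ℙ ℂ (Cx V)) (s : Set ℝ)
    (k : ℝ) : Prop where
  mem : ∀ t ∈ s, c t ∈ periodDomain B
  smooth : ∃ ζ ζ' : ℝ → Cx V, CurveContDiffOn ∞ ζ s ∧ (∀ t ∈ s, Represents (c t) (ζ t)) ∧
    (∀ t ∈ s, CurveHasDerivWithinAt ζ (ζ' t) s t) ∧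
    ∀ t ∈ s, tangentNorm B (ζ t) (ζ' t) = ENNReal.ofReal k
  minimizing : ∀ t ∈ s, ∃ ε > 0, ∀ r ∈ s, ∀ r' ∈ s, |r - t| < ε → |r' - t| < ε →
    riemannianDist B (c r) (c r') = ENNReal.ofReal (k * |r - r'|)

/-- The connected component of `p₀` in the period domain (the period domain is a manifold, so this
is the path component). -/
def periodComponent (B : LinearMap.BilinForm ℝ V) (p₀ : ℙ ℂ (Cx V)) : Set (ℙ ℂ (Cx V)) :=
  {p | ∃ ζ : ℝ → Cx V, CurveContinuousOn ζ (Set.Icc 0 1) ∧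
    (∀ t ∈ Set.Icc (0 : ℝ) 1, ζ t ∈ periodCone B) ∧ Represents p₀ (ζ 0) ∧ Represents p (ζ 1)}

/-! ## The tube domain -/

/-- The tube domain `T(V, v)` of an isotropic vector `v`: pairs of classes `x`, `y` in `V / ℝ v`
with `x.v = -1`, `y.v = 0` and `y.y > 0`. (For isotropic `v` these numbers do not depend on the
representatives.) -/
structure TubeDomain (B : LinearMap.BilinForm ℝ V) (v : V) where
  x : V ⧸ Submodule.span ℝ {v}
  y : V ⧸ Submodule.span ℝ {v}
  x_mem : ∀ a : V, Submodule.Quotient.mk a = x → B a v = -1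
  y_mem : ∀ a : V, Submodule.Quotient.mk a = y → B a v = 0
  y_pos : ∀ a : V, Submodule.Quotient.mk a = y → 0 < B a a

/-- The point `x + i y` of the tube domain given by lifts `a`, `c` of `x`, `y` to `V`. -/
def TubeDomain.ofLifts {B : LinearMap.BilinForm ℝ V} {v : V} (a c : V) (hv : B v v = 0)
    (ha : B a v = -1) (hc : B c v = 0) (hc' : B v c = 0) (hpos : 0 < B c c) :
    TubeDomain B v where
  x := Submodule.Quotient.mk a
  y := Submodule.Quotient.mk c
  x_mem := by
    intro a' h
    rw [Submodule.Quotient.eq, Submodule.mem_span_singleton] at h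
    obtain ⟨r, hr⟩ := h
    rw [eq_sub_iff_add_eq] at hr
    simp [← hr, hv, ha]
  y_mem := by
    intro c' h
    rw [Submodule.Quotient.eq, Submodule.mem_span_singleton] at h
    obtain ⟨r, hr⟩ := h
    rw [eq_sub_iff_add_eq] at hr
    simp [← hr, hv, hc]
  y_pos := by
    intro c' h
    rw [Submodule.Quotient.eq, Submodule.mem_span_singleton] at h
    obtain ⟨r, hr⟩ := h
    rw [eq_sub_iff_add_eq] at hr
    simpa [← hr, hv, hc, hc'] using hpos

/-- The point `x + i r y` of the tube domain, for `r > 0`. -/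
def TubeDomain.scale {B : LinearMap.BilinForm ℝ V} {v : V} (τ : TubeDomain B v) (r : ℝ)
    (hr : 0 < r) : TubeDomain B v where
  x := τ.x
  y := r • τ.y
  x_mem := τ.x_mem
  y_mem := by
    intro a ha
    have h := τ.y_mem (r⁻¹ • a) (by
      rw [Submodule.Quotient.mk_smul, ha, smul_smul, inv_mul_cancel₀ hr.ne', one_smul])
    simpa [hr.ne'] using h
  y_pos := by
    intro a ha
    have h := τ.y_pos (r⁻¹ • a) (by
      rw [Submodule.Quotient.mk_smul, ha, smul_smul, inv_mul_cancel₀ hr.ne', one_smul])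
    have h2 : B (r⁻¹ • a) (r⁻¹ • a) = r⁻¹ * (r⁻¹ * B a a) := by simp
    rw [h2] at h
    have hi : 0 < r⁻¹ := inv_pos.mpr hr
    exact (mul_pos_iff_of_pos_left hi).mp ((mul_pos_iff_of_pos_left hi).mp h)

/-- The vector `z = a + ½ (a.a) v` with `a` a lift of `x + i y` to `V_ℂ`. It does not depend on the
lift and is the only vector over `x + i y` with `z.z = 0`, see `tubeVec_unique`. -/
def tubeVec {B : LinearMap.BilinForm ℝ V} {v : V} (τ : TubeDomain B v) : Cx V :=
  let a : Cx V := ofReIm (Quotient.out τ.x) (Quotient.out τ.y)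
  a + ((1 / 2 : ℂ) * cform B a a) • ((1 : ℂ) ⊗ₜ[ℝ] v)

theorem cform_one_tmul (B : LinearMap.BilinForm ℝ V) (v w : V) :
    cform B ((1 : ℂ) ⊗ₜ[ℝ] v) ((1 : ℂ) ⊗ₜ[ℝ] w) = (B v w : ℂ) := by
  simp [cform]

theorem cform_ofReIm_one_tmul (B : LinearMap.BilinForm ℝ V) (x y v : V) :
    cform B (ofReIm x y) ((1 : ℂ) ⊗ₜ[ℝ] v) = (B x v : ℂ) + (B y v : ℂ) * Complex.I := by
  simp [cform, ofReIm]

theorem TubeDomain.out_x {B : LinearMap.BilinForm ℝ V} {v : V} (τ : TubeDomain B v) :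
    B (Quotient.out τ.x) v = -1 := τ.x_mem _ (Quotient.out_eq _)

theorem TubeDomain.out_y {B : LinearMap.BilinForm ℝ V} {v : V} (τ : TubeDomain B v) :
    B (Quotient.out τ.y) v = 0 := τ.y_mem _ (Quotient.out_eq _)

theorem TubeDomain.isotropic {B : LinearMap.BilinForm ℝ V} {v : V} (τ : TubeDomain B v) :
    B v v = 0 := by
  have h := τ.y_mem (Quotient.out τ.y + v) (by
    rw [Submodule.Quotient.mk_add, (Submodule.Quotient.mk_eq_zero _).mpr
      (Submodule.mem_span_singleton_self v), add_zero]
    exact Quotient.out_eq _)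
  rw [map_add, LinearMap.add_apply, τ.out_y, zero_add] at h
  exact h

theorem cform_tubeVec_right {B : LinearMap.BilinForm ℝ V} {v : V} (τ : TubeDomain B v) :
    cform B (tubeVec τ) ((1 : ℂ) ⊗ₜ[ℝ] v) = -1 := by
  simp only [tubeVec, map_add, LinearMap.add_apply, map_smul, LinearMap.smul_apply,
    cform_ofReIm_one_tmul, cform_one_tmul, τ.out_x, τ.out_y, τ.isotropic]
  simp

theorem tubeVec_ne_zero {B : LinearMap.BilinForm ℝ V} {v : V} (τ : TubeDomain B v) :
    tubeVec τ ≠ 0 := by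
  intro h
  have h2 := cform_tubeVec_right τ
  rw [h] at h2
  simp at h2

/-- The point `exp_v(x + i y)` of `ℙ(V_ℂ)`. -/
def tubeExp {B : LinearMap.BilinForm ℝ V} {v : V} (τ : TubeDomain B v) : ℙ ℂ (Cx V) :=
  Projectivization.mk ℂ (tubeVec τ) (tubeVec_ne_zero τ)

theorem cform_symm {B : LinearMap.BilinForm ℝ V} (hB : B.IsSymm) (z w : Cx V) :
    cform B z w = cform B w z := by
  induction z using TensorProduct.induction_on with
  | zero => simp
  | add z z' hz hz' => simp only [map_add, LinearMap.add_apply, hz, hz']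
  | tmul a x =>
    induction w using TensorProduct.induction_on with
    | zero => simp
    | add w w' hw hw' => simp only [map_add, LinearMap.add_apply, hw, hw']
    | tmul c y => rw [cform, LinearMap.BilinForm.baseChange_tmul,
        LinearMap.BilinForm.baseChange_tmul, hB.eq x y, mul_comm a c]

theorem cform_v_v {B : LinearMap.BilinForm ℝ V} {v : V} (τ : TubeDomain B v) :
    cform B ((1 : ℂ) ⊗ₜ[ℝ] v) ((1 : ℂ) ⊗ₜ[ℝ] v) = 0 := by
  rw [cform_one_tmul, τ.isotropic, Complex.ofReal_zero]

theorem cform_add_smul_v {B : LinearMap.BilinForm ℝ V} (hB : B.IsSymm) {v : V}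
    (τ : TubeDomain B v) (a : Cx V) (ha : cform B a ((1 : ℂ) ⊗ₜ[ℝ] v) = -1) (c : ℂ) :
    cform B (a + c • ((1 : ℂ) ⊗ₜ[ℝ] v)) (a + c • ((1 : ℂ) ⊗ₜ[ℝ] v)) = cform B a a - 2 * c := by
  have h1 : cform B ((1 : ℂ) ⊗ₜ[ℝ] v) a = -1 := by rw [cform_symm hB, ha]
  simp only [map_add, LinearMap.add_apply, map_smul, LinearMap.smul_apply, ha, h1, cform_v_v τ,
    smul_eq_mul]
  ring

theorem tubeVec_isotropic {B : LinearMap.BilinForm ℝ V} (hB : B.IsSymm) {v : V}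
    (τ : TubeDomain B v) : cform B (tubeVec τ) (tubeVec τ) = 0 := by
  have h := cform_ofReIm_one_tmul B (Quotient.out τ.x) (Quotient.out τ.y) v
  rw [τ.out_x, τ.out_y] at h
  simp only [tubeVec]
  rw [cform_add_smul_v hB τ _ (by simpa using h)]
  ring

/-- `tubeVec τ` is the only vector `z` with `z.z = 0` that lies over `x + i y ∈ V_ℂ / ℂ v`. -/
theorem tubeVec_unique {B : LinearMap.BilinForm ℝ V} (hB : B.IsSymm) {v : V}
    (τ : TubeDomain B v) (a b : V) (ha : Submodule.Quotient.mk a = τ.x)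
    (hb : Submodule.Quotient.mk b = τ.y) (z : Cx V) :
    (cform B z z = 0 ∧ z - ofReIm a b ∈ Submodule.span ℂ {(1 : ℂ) ⊗ₜ[ℝ] v}) ↔ z = tubeVec τ := by
  have key : ∃ c : ℂ, ofReIm (Quotient.out τ.x) (Quotient.out τ.y)
      = ofReIm a b + c • ((1 : ℂ) ⊗ₜ[ℝ] v) := by
    have h1 : Submodule.Quotient.mk (p := Submodule.span ℝ {v}) (Quotient.out τ.x)
        = Submodule.Quotient.mk a := (Quotient.out_eq τ.x).trans ha.symm
    have h2 : Submodule.Quotient.mk (p := Submodule.span ℝ {v}) (Quotient.out τ.y)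
        = Submodule.Quotient.mk b := (Quotient.out_eq τ.y).trans hb.symm
    rw [Submodule.Quotient.eq, Submodule.mem_span_singleton] at h1 h2
    obtain ⟨r, hr⟩ := h1
    obtain ⟨s, hs⟩ := h2
    refine ⟨(r : ℂ) + (s : ℂ) * Complex.I, ?_⟩
    rw [eq_sub_iff_add_eq'] at hr hs
    rw [← hr, ← hs]
    have hrr : ((r : ℂ) • ((1 : ℂ) ⊗ₜ[ℝ] v)) = (1 : ℂ) ⊗ₜ[ℝ] (r • v) := by
      rw [TensorProduct.smul_tmul', TensorProduct.tmul_smul, TensorProduct.smul_tmul']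
      simp
    have hss : (((s : ℂ) * Complex.I) • ((1 : ℂ) ⊗ₜ[ℝ] v)) = Complex.I ⊗ₜ[ℝ] (s • v) := by
      rw [TensorProduct.smul_tmul', TensorProduct.tmul_smul, TensorProduct.smul_tmul']
      simp
    rw [add_smul, hrr, hss]
    simp only [ofReIm, TensorProduct.tmul_add]
    abel
  obtain ⟨c, hc⟩ := key
  constructor
  · rintro ⟨h0, hz⟩
    obtain ⟨d, hd⟩ := Submodule.mem_span_singleton.mp hz
    have hz' : z = ofReIm (Quotient.out τ.x) (Quotient.out τ.y)
        + (d - c) • ((1 : ℂ) ⊗ₜ[ℝ] v) := by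
      rw [hc, sub_smul, hd]; abel
    have h := cform_ofReIm_one_tmul B (Quotient.out τ.x) (Quotient.out τ.y) v
    rw [τ.out_x, τ.out_y] at h
    rw [hz', cform_add_smul_v hB τ _ (by simpa using h)] at h0
    rw [hz']
    simp only [tubeVec]
    congr 2
    linear_combination (-1 / 2 : ℂ) * h0
  · rintro rfl
    refine ⟨tubeVec_isotropic hB τ, ?_⟩
    simp only [tubeVec]
    rw [hc, add_assoc, add_sub_cancel_left, ← add_smul]
    exact Submodule.smul_mem _ _ (Submodule.mem_span_singleton_self _)

end RealSpace

/-! ## Lattices and quotients of the period domain -/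

section Lattice

variable {N : Type u} [AddCommGroup N]

/-- The form on `N_ℝ = ℝ ⊗ N`. -/
def realForm (b : LinearMap.BilinForm ℤ N) : LinearMap.BilinForm ℝ (ℝ ⊗[ℤ] N) :=
  LinearMap.BilinForm.baseChange ℝ b

/-- The map `N → N_ℝ`. -/
def toReal (n : N) : ℝ ⊗[ℤ] N := (1 : ℝ) ⊗ₜ[ℤ] n

theorem realForm_toReal (b : LinearMap.BilinForm ℤ N) (m n : N) :
    realForm b (toReal m) (toReal n) = (b m n : ℝ) := by
  simp [realForm, toReal]

/-- `v` is a primitive isotropic vector. -/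
def IsPrimitiveIsotropic (b : LinearMap.BilinForm ℤ N) (v : N) : Prop :=
  b v v = 0 ∧ ∀ (n : ℤ) (w : N), v = n • w → IsUnit n

/-- `v` is a standard vector: it is isotropic, and the products `v.w`, `w ∈ N`, have greatest common
divisor `1`. -/
def IsStandard (b : LinearMap.BilinForm ℤ N) (v : N) : Prop :=
  b v v = 0 ∧ Ideal.span (Set.range fun w => b v w) = ⊤

/-- The action of an automorphism of `N` on `N_ℂ`. -/
def cxMap (f : N ≃ₗ[ℤ] N) : Cx (ℝ ⊗[ℤ] N) ≃ₗ[ℂ] Cx (ℝ ⊗[ℤ] N) :=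
  LinearEquiv.baseChange ℝ ℂ _ _ (LinearEquiv.baseChange ℤ ℝ _ _ f)

theorem cxMap_one (z : Cx (ℝ ⊗[ℤ] N)) : cxMap (1 : N ≃ₗ[ℤ] N) z = z := by
  simp [cxMap, LinearEquiv.baseChange_one]

theorem cxMap_mul (f g : N ≃ₗ[ℤ] N) (z : Cx (ℝ ⊗[ℤ] N)) :
    cxMap (f * g) z = cxMap f (cxMap g z) := by
  simp [cxMap, LinearEquiv.baseChange_mul]

/-- The action of an automorphism of `N` on `ℙ(N_ℂ)`. -/
def act (f : N ≃ₗ[ℤ] N) : ℙ ℂ (Cx (ℝ ⊗[ℤ] N)) → ℙ ℂ (Cx (ℝ ⊗[ℤ] N)) :=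
  Projectivization.map (cxMap f).toLinearMap (cxMap f).injective

theorem act_one (p : ℙ ℂ (Cx (ℝ ⊗[ℤ] N))) : act (1 : N ≃ₗ[ℤ] N) p = p := by
  induction p using Projectivization.ind with
  | h z hz =>
    simp only [act, Projectivization.map_mk]
    congr 1
    exact cxMap_one z

theorem act_mul (f g : N ≃ₗ[ℤ] N) (p : ℙ ℂ (Cx (ℝ ⊗[ℤ] N))) :
    act (f * g) p = act f (act g p) := by
  induction p using Projectivization.ind with
  | h z hz =>
    simp only [act, Projectivization.map_mk]
    congr 1
    exact cxMap_mul f g z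

theorem act_inv_act (f : N ≃ₗ[ℤ] N) (p : ℙ ℂ (Cx (ℝ ⊗[ℤ] N))) : act f⁻¹ (act f p) = p := by
  rw [← act_mul, inv_mul_cancel, act_one]

theorem act_act_inv (f : N ≃ₗ[ℤ] N) (p : ℙ ℂ (Cx (ℝ ⊗[ℤ] N))) : act f (act f⁻¹ p) = p := by
  rw [← act_mul, mul_inv_cancel, act_one]

/-- The group of isometries of `N` that preserve the connected component of `p₀` in the period
domain. -/
def isometriesPlus (b : LinearMap.BilinForm ℤ N) (p₀ : ℙ ℂ (Cx (ℝ ⊗[ℤ] N))) :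
    Subgroup (N ≃ₗ[ℤ] N) where
  carrier := {f | (∀ x y, b (f x) (f y) = b x y) ∧
    ∀ p, act f p ∈ periodComponent (realForm b) p₀ ↔ p ∈ periodComponent (realForm b) p₀}
  mul_mem' := by
    rintro f g ⟨hf, hf'⟩ ⟨hg, hg'⟩
    refine ⟨fun x y => ?_, fun p => ?_⟩
    · rw [LinearEquiv.mul_apply, LinearEquiv.mul_apply, hf, hg]
    · rw [act_mul, hf', hg']
  one_mem' := ⟨fun _ _ => rfl, fun p => by rw [act_one]⟩
  inv_mem' := by
    rintro f ⟨hf, hf'⟩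
    refine ⟨fun x y => ?_, fun p => ?_⟩
    · have h := hf (f⁻¹ x) (f⁻¹ y)
      rw [← LinearEquiv.mul_apply, ← LinearEquiv.mul_apply, mul_inv_cancel] at h
      exact h.symm
    · rw [← hf', act_act_inv]

/-- Two points of the component of `p₀` are equivalent if they lie in the same `Γ`-orbit. -/
def orbitSetoid (b : LinearMap.BilinForm ℤ N) (p₀ : ℙ ℂ (Cx (ℝ ⊗[ℤ] N)))
    (Γ : Subgroup (N ≃ₗ[ℤ] N)) : Setoid (periodComponent (realForm b) p₀) where
  r p q := ∃ f ∈ Γ, act f p.1 = q.1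
  iseqv := by
    refine ⟨fun p => ⟨1, Γ.one_mem, act_one _⟩, ?_, ?_⟩
    · rintro p q ⟨f, hf, h⟩
      exact ⟨f⁻¹, Γ.inv_mem hf, by rw [← h, act_inv_act]⟩
    · rintro p q r ⟨f, hf, h⟩ ⟨g, hg, h'⟩
      exact ⟨g * f, Γ.mul_mem hg hf, by rw [act_mul, h, h']⟩

/-- The quotient `Γ \ 𝒟⁺`, where `𝒟⁺` is the connected component of `p₀` in the period domain. -/
def PeriodQuotient (b : LinearMap.BilinForm ℤ N) (p₀ : ℙ ℂ (Cx (ℝ ⊗[ℤ] N)))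
    (Γ : Subgroup (N ≃ₗ[ℤ] N)) : Type u :=
  Quotient (orbitSetoid b p₀ Γ)

variable {b : LinearMap.BilinForm ℤ N} {p₀ : ℙ ℂ (Cx (ℝ ⊗[ℤ] N))} {Γ : Subgroup (N ≃ₗ[ℤ] N)}

/-- The point `p` of `ℙ(N_ℂ)` lies in `𝒟⁺` and its image in `Γ \ 𝒟⁺` is `m`. -/
def IsLift (m : PeriodQuotient b p₀ Γ) (p : ℙ ℂ (Cx (ℝ ⊗[ℤ] N))) : Prop :=
  ∃ h : p ∈ periodComponent (realForm b) p₀, m = Quotient.mk (orbitSetoid b p₀ Γ) ⟨p, h⟩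

/-- The path `γ(t)`, `t ≫ 0`, in `Γ \ 𝒟⁺` is a linear degeneration to the cusp `[v] = Γ · v`: it has
a lift `exp_w(x₀ + i t y₀)` to `𝒟⁺` with `w ∈ Γ · v`. -/
def IsLinearDegeneration (γ : ℝ → PeriodQuotient b p₀ Γ) (v : N) : Prop :=
  ∃ f ∈ Γ, ∃ τ : TubeDomain (realForm b) (toReal (f v)),
    ∀ᶠ t in Filter.atTop, ∃ ht : 0 < t, IsLift (γ t) (tubeExp (τ.scale t ht))

/-- Geodesics (of constant speed `k`, on the open interval `s`) of `Γ \ 𝒟⁺` are the images of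
geodesics in `𝒟⁺`. -/
def IsQuotientGeodesicOn (γ : ℝ → PeriodQuotient b p₀ Γ) (s : Set ℝ) (k : ℝ) : Prop :=
  ∃ c : ℝ → ℙ ℂ (Cx (ℝ ⊗[ℤ] N)), IsGeodesicOn (realForm b) c s k ∧ ∀ t ∈ s, IsLift (γ t) (c t)

end Lattice

/-! ## The Kähler moduli space of a projective K3 surface -/

/-- The lattice and Hodge theoretic data of a projective K3 surface `X`: the even unimodular lattice
`Λ = H²(X, ℤ)` of signature `(3, 19)` with the intersection form, a generator `σ` of `H^{2,0}(X)`,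
and an ample class `h`. By the Torelli theorem and the surjectivity of the period map, these data
are the same as a projective K3 surface with an ample class. -/
structure K3Data (Λ : Type u) [AddCommGroup Λ] [Module.Free ℤ Λ] [Module.Finite ℤ Λ] where
  form : LinearMap.BilinForm ℤ Λ
  even : ∀ x, Even (form x x)
  unimodular : Function.Bijective form
  signature : HasSignature (realForm form) 3 19
  σ : Cx (ℝ ⊗[ℤ] Λ)
  σ_mem : σ ∈ periodCone (realForm form)
  h : Λ
  h_algebraic : cform (realForm form) ((1 : ℂ) ⊗ₜ[ℝ] toReal h) σ = 0
  h_pos : 0 < form h h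
  h_ample : ∀ δ : Λ, cform (realForm form) ((1 : ℂ) ⊗ₜ[ℝ] toReal δ) σ = 0 → form δ δ = -2 →
    form h δ ≠ 0

namespace K3Data

variable {Λ : Type u} [AddCommGroup Λ] [Module.Free ℤ Λ] [Module.Finite ℤ Λ] (X : K3Data Λ)

/-- `NS(X) = H^{1,1}(X) ∩ H²(X, ℤ)`. -/
def NS : Submodule ℤ Λ where
  carrier := {l | cform (realForm X.form) ((1 : ℂ) ⊗ₜ[ℝ] toReal l) X.σ = 0}
  zero_mem' := by simp [toReal]
  add_mem' := by
    intro a b ha hb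
    simp only [Set.mem_ofPred_eq, toReal, TensorProduct.tmul_add, map_add,
      LinearMap.add_apply] at ha hb ⊢
    rw [ha, hb, add_zero]
  smul_mem' := by
    intro n a ha
    simp only [Set.mem_ofPred_eq, toReal] at ha ⊢
    rw [TensorProduct.tmul_smul, TensorProduct.tmul_smul, map_zsmul, LinearMap.smul_apply, ha,
      smul_zero]

/-- The Mukai pairing `(r, l, s).(r', l', s') = l.l' - r s' - r' s` on
`H̃(X, ℤ) = H⁰(X, ℤ) ⊕ H²(X, ℤ) ⊕ H⁴(X, ℤ)`. -/
def mukaiForm : LinearMap.BilinForm ℤ (ℤ × Λ × ℤ) :=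
  LinearMap.mk₂ ℤ (fun x y => X.form x.2.1 y.2.1 - x.1 * y.2.2 - y.1 * x.2.2)
    (by intros; simp; ring) (by intros; simp; ring) (by intros; simp; ring)
    (by intros; simp; ring)

/-- The extended Néron-Severi lattice `N(X) = H⁰(X, ℤ) ⊕ NS(X) ⊕ H⁴(X, ℤ)`. -/
def extNS : Submodule ℤ (ℤ × Λ × ℤ) := Submodule.prod ⊤ (Submodule.prod X.NS ⊤)

/-- The Mukai pairing on `N(X)`. -/
def extForm : LinearMap.BilinForm ℤ X.extNS := X.mukaiForm.restrict X.extNS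

/-- The generator of `H̃^{2,0}(X) = H^{2,0}(X)` in `H̃(X, ℂ)`. -/
def mukaiPeriod : Cx (ℝ ⊗[ℤ] (ℤ × Λ × ℤ)) :=
  LinearMap.baseChange ℂ (LinearMap.baseChange ℝ
    (LinearMap.inr ℤ ℤ (Λ × ℤ) ∘ₗ LinearMap.inl ℤ Λ ℤ)) X.σ

/-- The group `O_Hodge(H̃(X, ℤ))` of Hodge isometries: isometries that preserve the line `H̃^{2,0}(X)`
(and then also its conjugate `H̃^{0,2}(X)` and `H̃^{1,1}(X)`, the orthogonal complement of both). -/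
def hodgeIsometries : Subgroup ((ℤ × Λ × ℤ) ≃ₗ[ℤ] (ℤ × Λ × ℤ)) where
  carrier := {g | (∀ x y, X.mukaiForm (g x) (g y) = X.mukaiForm x y) ∧
    ∃ c : ℂˣ, cxMap g X.mukaiPeriod = (c : ℂ) • X.mukaiPeriod}
  mul_mem' := by
    rintro f g ⟨hf, c, hc⟩ ⟨hg, d, hd⟩
    refine ⟨fun x y => ?_, d * c, ?_⟩
    · rw [LinearEquiv.mul_apply, LinearEquiv.mul_apply, hf, hg]
    · rw [cxMap_mul, hd, map_smul, hc, smul_smul, Units.val_mul]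
  one_mem' := ⟨fun _ _ => rfl, 1, by rw [cxMap_one, Units.val_one, one_smul]⟩
  inv_mem' := by
    rintro f ⟨hf, c, hc⟩
    refine ⟨fun x y => ?_, c⁻¹, ?_⟩
    · have h := hf (f⁻¹ x) (f⁻¹ y)
      rw [← LinearEquiv.mul_apply, ← LinearEquiv.mul_apply, mul_inv_cancel] at h
      exact h.symm
    · have h := congrArg (fun z => ((c⁻¹ : ℂˣ) : ℂ) • cxMap f⁻¹ z) hc
      simp only [map_smul] at h
      rw [← cxMap_mul, inv_mul_cancel, cxMap_one, smul_smul, Units.inv_mul, one_smul] at h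
      exact h.symm

/-- The isotropic vector `v₀ = (0, 0, 1)` of `N(X)`. -/
def v₀ : X.extNS := ⟨(0, 0, 1), by simp [extNS]⟩

/-- The vector `(1, 0, 0)` of `N(X)`. -/
def e₀ : X.extNS := ⟨(1, 0, 0), by simp [extNS]⟩

/-- The vector `(0, h, 0)` of `N(X)`. -/
def h₀ : X.extNS := ⟨(0, X.h, 0), ⟨trivial, X.h_algebraic, trivial⟩⟩

/-- The point `x + i y` of the tube domain of `(N(X), v₀)` with `x` the class of `(1, 0, 0)` (that
is, the zero class of `NS(X)`) and `y = h` the ample class. -/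
def amplePoint : TubeDomain (realForm X.extForm) (toReal X.v₀) :=
  TubeDomain.ofLifts (toReal X.e₀) (toReal X.h₀)
    (by rw [realForm_toReal]; simp [extForm, mukaiForm, v₀])
    (by rw [realForm_toReal]; simp [extForm, mukaiForm, v₀, e₀])
    (by rw [realForm_toReal]; simp [extForm, mukaiForm, v₀, h₀])
    (by rw [realForm_toReal]; simp [extForm, mukaiForm, v₀, h₀])
    (by rw [realForm_toReal]; simpa [extForm, mukaiForm, h₀] using X.h_pos)

/-- The point `exp_{v₀}(i h)`; its connected component in the period domain is `𝒟⁺(X)`. -/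
def basePoint : ℙ ℂ (Cx (ℝ ⊗[ℤ] X.extNS)) := tubeExp X.amplePoint

/-- The group `Γ_X⁺`: the image in `O(N(X))` of the group of those Hodge isometries of `H̃(X, ℤ)`
that preserve `𝒟⁺(X)`. -/
def gammaPlus : Subgroup (X.extNS ≃ₗ[ℤ] X.extNS) where
  carrier := {f | f ∈ isometriesPlus X.extForm X.basePoint ∧
    ∃ g ∈ X.hodgeIsometries, ∀ n : X.extNS, g n.1 = (f n).1}
  mul_mem' := by
    rintro f f' ⟨hf, g, hg, h⟩ ⟨hf', g', hg', h'⟩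
    exact ⟨mul_mem hf hf', g * g', mul_mem hg hg', fun n => by
      rw [LinearEquiv.mul_apply, LinearEquiv.mul_apply, h', h]⟩
  one_mem' := ⟨one_mem _, 1, one_mem _, fun _ => rfl⟩
  inv_mem' := by
    rintro f ⟨hf, g, hg, h⟩
    refine ⟨inv_mem hf, g⁻¹, inv_mem hg, fun n => ?_⟩
    have h2 := h (f⁻¹ n)
    rw [← LinearEquiv.mul_apply f, mul_inv_cancel] at h2
    change _ = n.1 at h2
    rw [← h2, ← LinearEquiv.mul_apply, inv_mul_cancel]
    rfl

/-- The Kähler moduli space `KM(X) = Γ_X⁺ \ 𝒟⁺(X)`. -/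
abbrev KM : Type u := PeriodQuotient X.extForm X.basePoint X.gammaPlus

end K3Data

end KahlerPeriod

end

/-! The geodesics are detected by a calibration. Let `v` be isotropic and not in the radical, n =
dim V and k = √(2(n - 2)). The function log(Re z.Re z) - log |z.v|² (`busemann`) does not change
when z is rescaled, so it lives on the period domain. Its differential is at most 2/k times the
Riemannian norm (`busemannDeriv_le_tangentNorm`), hence every path is at least k/2 times as long as
the change of the function between its ends (`le_length`). Along exp_v(x + i e^t y) the function is
2t + const (`busemann_tubeLift`), while the curve is the orbit of a one-parameter group of boosts
and has speed at most k (`tangentNorm_tubeLift_le`). The two bounds meet: the distance between the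
points at t and t' is exactly k|t - t'| (`riemannianDist_tubeLift`), so the curve minimizes length
globally.

The bound on the differential is a computation in 𝔰𝔬(V). The Killing form is (n - 2) tr X²
(`killingForm_soLie`). If X exchanges P and P^⊥, then tr X² comes equally from both, and is
expressed by the norms of X(Re z) and X(Im z) (`trace_sq_of_mem_cartanComplement`). These vectors
lie in P^⊥, where the form is negative semidefinite, so Cauchy-Schwarz against the P^⊥-component of
`v` gives the estimate; as `v` is isotropic, the norm of that component is minus the norm of the
P-component, a multiple of |z.v|².

Geodesics of a quotient are images of geodesics upstairs, so the case of linear degenerations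
follows from the lift in their definition. The form enters only as a symmetric non-degenerate form
without three orthogonal positive vectors. For N(X) these properties are derived from the signature
(3, 19) of H². -/

noncomputable section

namespace KahlerPeriod

/-! ### The Killing form of 𝔰𝔬(V, B) via traces of operators on matrices -/

section KillingForm

open Matrix

variable {n : Type*} [Fintype n] [DecidableEq n]

/-- The linear map `M ↦ A M C` on square matrices. -/
def sandwich (A C : Matrix n n ℝ) : Matrix n n ℝ →ₗ[ℝ] Matrix n n ℝ :=
  LinearMap.mulLeft ℝ A ∘ₗ LinearMap.mulRight ℝ C

@[simp]
theorem sandwich_apply (A C M : Matrix n n ℝ) : sandwich A C M = A * (M * C) := rfl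

/-- The linear map `M ↦ A Mᵀ C` on square matrices. -/
def sandwichTranspose (A C : Matrix n n ℝ) : Matrix n n ℝ →ₗ[ℝ] Matrix n n ℝ :=
  sandwich A C ∘ₗ (Matrix.transposeLinearEquiv n n ℝ ℝ).toLinearMap

@[simp]
theorem sandwichTranspose_apply (A C M : Matrix n n ℝ) :
    sandwichTranspose A C M = A * (Mᵀ * C) := rfl

theorem trace_end_matrix (Φ : Matrix n n ℝ →ₗ[ℝ] Matrix n n ℝ) :
    LinearMap.trace ℝ _ Φ = ∑ i, ∑ j, Φ (Matrix.single i j 1) i j := by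
  rw [LinearMap.trace_eq_matrix_trace ℝ (Matrix.stdBasis ℝ n n), Matrix.trace,
    Fintype.sum_prod_type]
  refine Finset.sum_congr rfl fun i _ => Finset.sum_congr rfl fun j _ => ?_
  rw [Matrix.diag_apply, LinearMap.toMatrix_apply, Matrix.stdBasis_eq_single]
  simp [Matrix.stdBasis]

theorem trace_sandwich (A C : Matrix n n ℝ) :
    LinearMap.trace ℝ _ (sandwich A C) = A.trace * C.trace := by
  rw [trace_end_matrix, Matrix.trace, Matrix.trace, Finset.sum_mul_sum]
  refine Finset.sum_congr rfl fun i _ => Finset.sum_congr rfl fun j _ => ?_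
  simp [Matrix.mul_apply, Matrix.single_apply, Finset.sum_ite_eq, ite_and]

theorem trace_sandwichTranspose (A C : Matrix n n ℝ) :
    LinearMap.trace ℝ _ (sandwichTranspose A C) = (A * Cᵀ).trace := by
  rw [trace_end_matrix, Matrix.trace]
  refine Finset.sum_congr rfl fun i _ => ?_
  rw [Matrix.diag_apply, Matrix.mul_apply]
  refine Finset.sum_congr rfl fun j _ => ?_
  simp [Matrix.mul_apply, Matrix.single_apply, Finset.sum_ite_eq, ite_and]

variable {V : Type u} [AddCommGroup V] [Module ℝ V]

attribute [local instance 100] LieRing.ofAssociativeRing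

theorem mem_soLie_iff {B : LinearMap.BilinForm ℝ V} {X : Module.End ℝ V} :
    X ∈ soLie B ↔ ∀ u w, B (X u) w = -B u (X w) := by
  change X ∈ LinearMap.skewAdjointSubmodule B ↔ _
  rw [LinearMap.mem_skewAdjointSubmodule]
  simp [LinearMap.IsSkewAdjoint, LinearMap.IsAdjointPair]

theorem mem_soLie_iff_toMatrix {B : LinearMap.BilinForm ℝ V} (e : Module.Basis n ℝ V)
    {X : Module.End ℝ V} : X ∈ soLie B ↔ (LinearMap.toMatrix e e X)ᵀ *
      LinearMap.BilinForm.toMatrix e B = -(LinearMap.BilinForm.toMatrix e B *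
        LinearMap.toMatrix e e X) := by
  rw [← LinearMap.BilinForm.toMatrix_compLeft, ← LinearMap.BilinForm.toMatrix_compRight, ← map_neg,
    (LinearMap.BilinForm.toMatrix e).injective.eq_iff, mem_soLie_iff]
  constructor
  · intro h
    ext u w
    simpa using h u w
  · intro h u w
    simpa using LinearMap.congr_fun (LinearMap.congr_fun h u) w

/-- The Killing form of `𝔰𝔬(V, B)` is `(dim V - 2)` times the trace form of `V`. -/
theorem killingForm_soLie [FiniteDimensional ℝ V] {B : LinearMap.BilinForm ℝ V} (hB : B.IsSymm)
    (hB' : B.Nondegenerate) (X : soLie B) : killingForm ℝ (soLie B) X X =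
      (Module.finrank ℝ V - 2) * LinearMap.trace ℝ V (X.1 * X.1) := by
  set e := Module.finBasis ℝ V
  set G := LinearMap.BilinForm.toMatrix e B with hG
  have hdet : G.det ≠ 0 := (LinearMap.BilinForm.nondegenerate_iff_det_ne_zero e).mp hB'
  have hGu : IsUnit G.det := isUnit_iff_ne_zero.mpr hdet
  have hGs : Gᵀ = G := by
    ext i j
    simp [hG, LinearMap.BilinForm.toMatrix_apply, hB.eq (e i) (e j)]
  have hGis : (G⁻¹)ᵀ = G⁻¹ := by rw [Matrix.transpose_nonsing_inv, hGs]
  set ι : soLie B →ₗ[ℝ] Matrix _ _ ℝ :=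
    (LinearMap.toMatrix e e).toLinearMap ∘ₗ (soLie B).toSubmodule.subtype with hι
  have hιc : ∀ Y : soLie B, ι Y = LinearMap.toMatrix e e Y.1 := fun _ => rfl
  have hιX : ∀ Y : soLie B, (ι Y)ᵀ * G = -(G * ι Y) := fun Y =>
    (mem_soLie_iff_toMatrix e).mp Y.2
  -- The projection of all matrices onto 𝔰𝔬 along the self-adjoint ones: M ↦ G⁻¹MᵀG is the adjoint
  -- involution, and 𝔰𝔬 is its (-1)-eigenspace.
  set p : Matrix _ _ ℝ →ₗ[ℝ] Matrix _ _ ℝ :=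
    (1 / 2 : ℝ) • (LinearMap.id - sandwichTranspose G⁻¹ G) with hp
  have hpmem : ∀ M, Matrix.toLin e e (p M) ∈ (soLie B).toSubmodule := by
    intro M
    rw [LieSubalgebra.mem_toSubmodule, mem_soLie_iff_toMatrix e, LinearMap.toMatrix_toLin, ← hG]
    simp only [hp, LinearMap.smul_apply, LinearMap.sub_apply, LinearMap.id_apply,
      sandwichTranspose_apply, Matrix.transpose_smul, Matrix.transpose_sub, Matrix.transpose_mul,
      hGs, hGis, Matrix.transpose_transpose, Matrix.smul_mul, Matrix.mul_smul, Matrix.sub_mul,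
      Matrix.mul_sub, Matrix.mul_nonsing_inv_cancel_left _ _ hGu, Matrix.mul_assoc,
      Matrix.nonsing_inv_mul _ hGu, Matrix.mul_one]
    rw [← smul_neg, neg_sub]
  set q : Matrix _ _ ℝ →ₗ[ℝ] soLie B :=
    LinearMap.codRestrict (soLie B).toSubmodule ((Matrix.toLin e e).toLinearMap ∘ₗ p) hpmem with hq
  set x := ι X with hx
  -- This is M ↦ [x, [x, M]], the square of ad x on all matrices. Since `q` retracts onto 𝔰𝔬 and `ι
  -- ∘ q = p`, the trace of (ad X)² on 𝔰𝔬 becomes the trace of `T ∘ p` on matrices.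
  set T : Matrix _ _ ℝ →ₗ[ℝ] Matrix _ _ ℝ :=
    sandwich (x * x) 1 - (2 : ℝ) • sandwich x x + sandwich 1 (x * x) with hT
  have hιq : ι ∘ₗ q = p := by
    ext1 M
    exact LinearMap.toMatrix_toLin e e (p M)
  have hqι : ∀ Y, q (ι Y) = Y := by
    intro Y
    apply Subtype.ext
    apply (LinearMap.toMatrix e e).injective
    change ι (q (ι Y)) = ι Y
    have : ι (q (ι Y)) = p (ι Y) := LinearMap.congr_fun hιq (ι Y)
    rw [this]
    simp only [hp, LinearMap.smul_apply, LinearMap.sub_apply, LinearMap.id_apply,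
      sandwichTranspose_apply, hιX, Matrix.mul_neg, Matrix.nonsing_inv_mul_cancel_left _ _ hGu,
      sub_neg_eq_add]
    rw [← two_smul ℝ, smul_smul]
    norm_num
  have had : LieAlgebra.ad ℝ (soLie B) X ∘ₗ LieAlgebra.ad ℝ (soLie B) X = q ∘ₗ (T ∘ₗ ι) := by
    ext1 Y
    have : ι ⁅X, ⁅X, Y⁆⁆ = T (ι Y) := by
      simp only [hT, hx, hιc, LieSubalgebra.coe_bracket, LieRing.of_associative_ring_bracket,
        LinearMap.add_apply, LinearMap.sub_apply, LinearMap.smul_apply, sandwich_apply, map_sub,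
        LinearMap.toMatrix_mul, Matrix.mul_one, Matrix.one_mul]
      rw [two_smul]
      noncomm_ring
    rw [LinearMap.comp_apply, LinearMap.comp_apply, LinearMap.comp_apply, ← this, hqι]
    rfl
  have htr : LinearMap.trace ℝ V (X.1 * X.1) = (x * x).trace := by
    rw [LinearMap.trace_eq_matrix_trace ℝ e, LinearMap.toMatrix_mul]
    rfl
  -- The transpose of x is conjugate to -x.
  have hx0 : x.trace = 0 := by
    have h1 : xᵀ = -(G * (x * G⁻¹)) := by
      have := congrArg (· * G⁻¹) (hιX X)
      simpa [Matrix.mul_assoc, Matrix.mul_nonsing_inv _ hGu] using this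
    have h2 := congrArg Matrix.trace h1
    rw [Matrix.trace_transpose, Matrix.trace_neg, Matrix.trace_mul_comm, Matrix.mul_assoc,
      Matrix.nonsing_inv_mul _ hGu, Matrix.mul_one] at h2
    linarith
  have hTp : T ∘ₗ p = (1 / 2 : ℝ) • (T - (sandwichTranspose (x * x * G⁻¹) G
      - (2 : ℝ) • sandwichTranspose (x * G⁻¹) (G * x) + sandwichTranspose G⁻¹ (G * (x * x)))) := by
    ext1 M
    simp only [hT, hp, LinearMap.comp_apply, LinearMap.add_apply, LinearMap.sub_apply,
      LinearMap.smul_apply, sandwich_apply, sandwichTranspose_apply, LinearMap.id_apply, map_smul,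
      map_sub, Matrix.mul_one, Matrix.one_mul, Matrix.mul_assoc]
  have h1 : x * G⁻¹ * (G * x)ᵀ = -(x * x) := by
    rw [Matrix.transpose_mul, hGs, hιX, Matrix.mul_neg, Matrix.mul_assoc,
      Matrix.nonsing_inv_mul_cancel_left _ _ hGu]
  have h2 : G⁻¹ * (G * (x * x))ᵀ = x * x := by
    rw [Matrix.transpose_mul, Matrix.transpose_mul, hGs, Matrix.mul_assoc, hιX, Matrix.mul_neg,
      ← Matrix.mul_assoc, hιX, Matrix.neg_mul, neg_neg, Matrix.mul_assoc,
      Matrix.nonsing_inv_mul_cancel_left _ _ hGu]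
  have h3 : x * x * G⁻¹ * Gᵀ = x * x := by
    rw [hGs, Matrix.mul_assoc, Matrix.nonsing_inv_mul _ hGu, Matrix.mul_one]
  -- With tr x = 0 the sandwich terms contribute 2n tr x² and the transposed ones 4 tr x²; half the
  -- difference is (n - 2) tr x².
  rw [killingForm_apply_apply, had, LinearMap.trace_comp_comm', LinearMap.comp_assoc, hιq, hTp, htr]
  simp only [hT, map_smul, map_sub, map_add, trace_sandwich, trace_sandwichTranspose, h1, h2, h3, hx0, Matrix.trace_neg,
    Matrix.trace_one, Fintype.card_fin, smul_eq_mul]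
  ring

end KillingForm

/-! ### Real and imaginary parts; the period cone in real terms -/

section ReIm

variable {V : Type u} [AddCommGroup V] [Module ℝ V]

@[simp]
theorem rePart_ofReIm (x y : V) : rePart (ofReIm x y) = x := by
  simp [rePart, ofReIm]

@[simp]
theorem imPart_ofReIm (x y : V) : imPart (ofReIm x y) = y := by
  simp [imPart, ofReIm]

@[simp]
theorem ofReIm_rePart_imPart (z : Cx V) : ofReIm (rePart z) (imPart z) = z := by
  induction z using TensorProduct.induction_on with
  | zero => simp [ofReIm]
  | add z w hz hw =>
    conv_rhs => rw [← hz, ← hw]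
    simp only [ofReIm, map_add, TensorProduct.tmul_add]
    abel
  | tmul c x =>
    have h : ofReIm (rePart (c ⊗ₜ[ℝ] x)) (imPart (c ⊗ₜ[ℝ] x))
        = (c.re : ℂ) ⊗ₜ[ℝ] x + (c.im * Complex.I : ℂ) ⊗ₜ[ℝ] x := by
      simp only [ofReIm, rePart, imPart, LinearMap.comp_apply, LinearMap.rTensor_tmul,
        LinearEquiv.coe_coe, TensorProduct.lid_tmul, ← TensorProduct.smul_tmul]
      simp
    rw [h, ← TensorProduct.add_tmul, Complex.re_add_im]

theorem ofReIm_add (x y x' y' : V) :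
    ofReIm x y + ofReIm x' y' = ofReIm (x + x') (y + y') := by
  simp only [ofReIm, TensorProduct.tmul_add]
  abel

theorem ofReIm_sub (x y x' y' : V) :
    ofReIm x y - ofReIm x' y' = ofReIm (x - x') (y - y') := by
  simp only [ofReIm, TensorProduct.tmul_sub]
  abel

theorem smul_ofReIm (c : ℂ) (x y : V) :
    c • ofReIm x y = ofReIm (c.re • x - c.im • y) (c.re • y + c.im • x) := by
  have h1 : ∀ (r : ℝ) (u : V), (1 : ℂ) ⊗ₜ[ℝ] (r • u) = (r : ℂ) ⊗ₜ[ℝ] u := fun r u => by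
    rw [← TensorProduct.smul_tmul]; simp
  have h2 : ∀ (r : ℝ) (u : V), Complex.I ⊗ₜ[ℝ] (r • u) = (r * Complex.I : ℂ) ⊗ₜ[ℝ] u :=
    fun r u => by rw [← TensorProduct.smul_tmul]; simp
  simp only [ofReIm, smul_add, TensorProduct.smul_tmul', smul_eq_mul, mul_one,
    TensorProduct.tmul_sub, TensorProduct.tmul_add, h1, h2]
  conv_lhs => rw [← Complex.re_add_im c, add_mul, TensorProduct.add_tmul, TensorProduct.add_tmul,
    mul_assoc, Complex.I_mul_I, mul_neg_one, TensorProduct.neg_tmul]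
  abel

theorem real_smul_ofReIm (r : ℝ) (x y : V) : r • ofReIm x y = ofReIm (r • x) (r • y) := by
  simp [ofReIm]

theorem conjCx_ofReIm (x y : V) : conjCx (ofReIm x y) = ofReIm x (-y) := by
  simp [conjCx, ofReIm, TensorProduct.neg_tmul, TensorProduct.tmul_neg]

theorem cform_ofReIm (B : LinearMap.BilinForm ℝ V) (x y x' y' : V) :
    cform B (ofReIm x y) (ofReIm x' y') =
      ((B x x' - B y y' : ℝ) : ℂ) + ((B x y' + B y x' : ℝ) : ℂ) * Complex.I := by
  simp only [cform, ofReIm, map_add, LinearMap.add_apply, LinearMap.BilinForm.baseChange_tmul]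
  simp
  ring

theorem baseChange_ofReIm {W : Type u} [AddCommGroup W] [Module ℝ W] (f : V →ₗ[ℝ] W) (x y : V) :
    LinearMap.baseChange ℂ f (ofReIm x y) = ofReIm (f x) (f y) := by
  simp [ofReIm]

/-- The real and imaginary parts of z.z = 0 give equal norms and orthogonality; then z.z̄ is twice
the norm of Re z. -/
theorem mem_periodCone_iff {B : LinearMap.BilinForm ℝ V} (hB : B.IsSymm) {z : Cx V} :
    z ∈ periodCone B ↔ B (rePart z) (imPart z) = 0 ∧
      B (imPart z) (imPart z) = B (rePart z) (rePart z) ∧ 0 < B (rePart z) (rePart z) := by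
  obtain ⟨x, y, rfl⟩ : ∃ x y, z = ofReIm x y := ⟨_, _, (ofReIm_rePart_imPart z).symm⟩
  have h := hB.eq y x
  simp only [periodCone, Set.mem_ofPred_eq, conjCx_ofReIm, cform_ofReIm, Complex.ext_iff,
    rePart_ofReIm, imPart_ofReIm, h]
  simp
  constructor
  · rintro ⟨⟨h1, h2⟩, h3⟩
    exact ⟨by linarith, by linarith, by linarith⟩
  · rintro ⟨h1, h2, h3⟩
    exact ⟨⟨by linarith, by linarith⟩, by linarith⟩

theorem smul_mem_periodCone {B : LinearMap.BilinForm ℝ V} (hB : B.IsSymm) {z : Cx V}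
    (hz : z ∈ periodCone B) {c : ℂ} (hc : c ≠ 0) : c • z ∈ periodCone B := by
  obtain ⟨h1, h2, h3⟩ := (mem_periodCone_iff hB).mp hz
  have h4 : B (imPart z) (rePart z) = 0 := (hB.eq _ _).symm.trans h1
  rw [mem_periodCone_iff hB, ← ofReIm_rePart_imPart z, smul_ofReIm]
  have hc' : 0 < c.re * c.re + c.im * c.im := Complex.normSq_pos.mpr hc
  simp only [rePart_ofReIm, imPart_ofReIm, map_add, map_sub, map_smul, LinearMap.add_apply,
    LinearMap.sub_apply, LinearMap.smul_apply, smul_eq_mul, h1, h2, h4]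
  exact ⟨by ring, by ring, by nlinarith [mul_pos hc' h3]⟩

end ReIm

/-! ### The Cartan complement 𝔪_P and the Cauchy-Schwarz estimate on P^⊥ -/

section CartanComplement

variable {V : Type u} [AddCommGroup V] [Module ℝ V] {B : LinearMap.BilinForm ℝ V}

/-- There are no three pairwise orthogonal vectors of positive norm. -/
def AtMostTwoPositive (B : LinearMap.BilinForm ℝ V) : Prop :=
  ∀ a b c, B a b = 0 → B a c = 0 → B b c = 0 → 0 < B a a → 0 < B b b → B c c ≤ 0

/-- Cauchy-Schwarz for a negative semidefinite form: the quadratic polynomial t ↦ (u + t w).(u + t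
w) is never positive, so its discriminant is at most 0. -/
theorem sq_le_mul_of_nonpos (hB : B.IsSymm) {W : Submodule ℝ V} (hW : ∀ w ∈ W, B w w ≤ 0)
    {u w : V} (hu : u ∈ W) (hw : w ∈ W) : B u w ^ 2 ≤ B u u * B w w := by
  have h : ∀ t : ℝ, B w w * (t * t) + 2 * B u w * t + B u u ≤ 0 := fun t => by
    have h1 := hW (u + t • w) (W.add_mem hu (W.smul_mem t hw))
    have h2 : B w u = B u w := hB.eq w u
    simp only [map_add, map_smul, LinearMap.add_apply, LinearMap.smul_apply, smul_eq_mul, h2] at h1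
    linarith
  have := discrim_le_zero_of_nonpos h
  rw [discrim] at this
  linarith

theorem mem_periodPlane {z : Cx V} {p : V} :
    p ∈ periodPlane z ↔ ∃ α β : ℝ, α • rePart z + β • imPart z = p :=
  Submodule.mem_span_pair

theorem mem_orthogonal_periodPlane {z : Cx V} {q : V} :
    q ∈ B.orthogonal (periodPlane z) ↔ B (rePart z) q = 0 ∧ B (imPart z) q = 0 := by
  rw [LinearMap.BilinForm.mem_orthogonal_iff]
  constructor
  · intro h
    exact ⟨h _ (mem_periodPlane.mpr ⟨1, 0, by simp⟩), h _ (mem_periodPlane.mpr ⟨0, 1, by simp⟩)⟩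
  · rintro ⟨h1, h2⟩ p hp
    obtain ⟨α, β, rfl⟩ := mem_periodPlane.mp hp
    simp [h1, h2]

theorem nonpos_of_mem_orthogonal (hB : B.IsSymm) (hpos : AtMostTwoPositive B) {z : Cx V}
    (hz : z ∈ periodCone B) : ∀ q ∈ B.orthogonal (periodPlane z), B q q ≤ 0 := by
  intro q hq
  obtain ⟨h1, h2, h3⟩ := (mem_periodCone_iff hB).mp hz
  obtain ⟨h4, h5⟩ := mem_orthogonal_periodPlane.mp hq
  exact hpos _ _ _ h1 h4 h5 h3 (h2 ▸ h3)

/-- The orthogonal projection to the plane `periodPlane z`. -/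
def periodProj (B : LinearMap.BilinForm ℝ V) (z : Cx V) : Module.End ℝ V :=
  (B (rePart z) (rePart z))⁻¹ •
    ((B (rePart z)).smulRight (rePart z) + (B (imPart z)).smulRight (imPart z))

theorem periodProj_apply (z : Cx V) (u : V) : periodProj B z u =
    (B (rePart z) (rePart z))⁻¹ • (B (rePart z) u • rePart z + B (imPart z) u • imPart z) := rfl

theorem periodProj_mem (z : Cx V) (u : V) : periodProj B z u ∈ periodPlane z := by
  rw [periodProj_apply, mem_periodPlane]
  exact ⟨_, _, by rw [smul_add, smul_smul, smul_smul]⟩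

theorem sub_periodProj_mem (hB : B.IsSymm) {z : Cx V} (hz : z ∈ periodCone B) (u : V) :
    u - periodProj B z u ∈ B.orthogonal (periodPlane z) := by
  obtain ⟨h1, h2, h3⟩ := (mem_periodCone_iff hB).mp hz
  have h4 : B (imPart z) (rePart z) = 0 := (hB.eq _ _).symm.trans h1
  rw [mem_orthogonal_periodPlane, periodProj_apply]
  simp only [map_sub, map_smul, map_add, smul_eq_mul, h1, h2, h4]
  constructor <;> field_simp <;> ring

theorem periodProj_of_mem_orthogonal {z : Cx V} {q : V}
    (hq : q ∈ B.orthogonal (periodPlane z)) : periodProj B z q = 0 := by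
  obtain ⟨h1, h2⟩ := mem_orthogonal_periodPlane.mp hq
  simp [periodProj_apply, h1, h2]

theorem periodProj_of_mem (hB : B.IsSymm) {z : Cx V} (hz : z ∈ periodCone B) {p : V}
    (hp : p ∈ periodPlane z) : periodProj B z p = p := by
  obtain ⟨h1, h2, h3⟩ := (mem_periodCone_iff hB).mp hz
  have h4 : B (imPart z) (rePart z) = 0 := (hB.eq _ _).symm.trans h1
  obtain ⟨α, β, rfl⟩ := mem_periodPlane.mp hp
  have h5 := h3.ne'
  simp only [periodProj_apply, map_smul, map_add, h1, h2, h4, smul_add, smul_smul]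
  congr 2 <;> simp [h5]

attribute [local instance 100] LieRing.ofAssociativeRing

/-- Since X exchanges P and P^⊥, the two blocks of X² have the same trace. The trace over P is read
off in the orthogonal basis Re z, Im z, and skewness turns u.X²u into -(Xu).(Xu). -/
theorem trace_sq_of_mem_cartanComplement [FiniteDimensional ℝ V] (hB : B.IsSymm) {z : Cx V}
    (hz : z ∈ periodCone B) {X : soLie B} (hX : X ∈ cartanComplement B z) :
    LinearMap.trace ℝ V (X.1 * X.1) = -2 * (B (rePart z) (rePart z))⁻¹ *
      (B (X.1 (rePart z)) (X.1 (rePart z)) + B (X.1 (imPart z)) (X.1 (imPart z))) := by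
  set π := periodProj B z with hπ
  have h1 : X.1 * (1 - π) = π * X.1 := by
    ext1 u
    have h2 : X.1 (π u) ∈ B.orthogonal (periodPlane z) := hX.1 _ (periodProj_mem z u)
    have h3 : X.1 (u - π u) ∈ periodPlane z := hX.2 _ (sub_periodProj_mem hB hz u)
    have h4 : π (X.1 u) = X.1 (u - π u) := by
      rw [← periodProj_of_mem hB hz h3, map_sub, map_sub, periodProj_of_mem_orthogonal h2, sub_zero]
    simpa using h4.symm
  -- Cyclicity of the trace turns the second summand into the first, which is a sum of two operators
  -- of rank one.
  have h2 : X.1 * X.1 = X.1 * X.1 * π + X.1 * (π * X.1) := by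
    rw [← h1]; noncomm_ring
  have h3 : X.1 * X.1 * π = (B (rePart z) (rePart z))⁻¹ •
      ((B (rePart z)).smulRight (X.1 (X.1 (rePart z)))
        + (B (imPart z)).smulRight (X.1 (X.1 (imPart z)))) := by
    ext1 u
    simp [hπ, periodProj_apply]
  have h4 : ∀ u, B u (X.1 (X.1 u)) = -B (X.1 u) (X.1 u) := fun u => by
    rw [mem_soLie_iff.mp X.2, neg_neg]
  rw [h2, map_add, LinearMap.trace_mul_comm ℝ X.1 (π * X.1), mul_assoc π,
    LinearMap.trace_mul_comm ℝ π, h3]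
  simp only [map_smul, map_add, LinearMap.trace_smulRight, h4, smul_eq_mul]
  ring

/-- For isotropic `v`, the norm of the projection of `v` to the plane of `z`, in terms of the
complementary projection. -/
theorem sub_periodProj_norm (hB : B.IsSymm) {z : Cx V} (hz : z ∈ periodCone B) {v : V}
    (hv : B v v = 0) : B (v - periodProj B z v) (v - periodProj B z v) =
      -((B (rePart z) (rePart z))⁻¹ * (B (rePart z) v ^ 2 + B (imPart z) v ^ 2)) := by
  have h1 := mem_orthogonal_periodPlane.mp (sub_periodProj_mem hB hz v)
  have h2 : ∀ w, B w v = B v w := fun w => hB.eq w v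
  have h3 : B (periodProj B z v) (v - periodProj B z v) = 0 := by
    nth_rewrite 1 [periodProj_apply]
    simp [h1]
  rw [map_sub B v, LinearMap.sub_apply, h3, sub_zero, map_sub, hv, periodProj_apply]
  simp only [map_smul, map_add, smul_eq_mul, h2]
  ring

/-- The infinitesimal form of the Lipschitz bound: it controls how fast z.v can change under X by
the trace form of X. -/
theorem sq_add_sq_le_of_mem_cartanComplement [FiniteDimensional ℝ V] (hB : B.IsSymm)
    (hpos : AtMostTwoPositive B) {z : Cx V} (hz : z ∈ periodCone B) {X : soLie B}
    (hX : X ∈ cartanComplement B z) {v : V} (hv : B v v = 0) :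
    B (X.1 (rePart z)) v ^ 2 + B (X.1 (imPart z)) v ^ 2 ≤
      LinearMap.trace ℝ V (X.1 * X.1) / 2 * (B (rePart z) v ^ 2 + B (imPart z) v ^ 2) := by
  have hq := sub_periodProj_mem hB hz v
  -- As X u lies in P^⊥, only the P^⊥-component of `v` matters; its norm is given by
  -- `sub_periodProj_norm`, and both factors on the right are nonpositive.
  have key : ∀ u ∈ periodPlane z, B (X.1 u) v ^ 2 ≤ B (X.1 u) (X.1 u) *
      -((B (rePart z) (rePart z))⁻¹ * (B (rePart z) v ^ 2 + B (imPart z) v ^ 2)) := by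
    intro u hu
    have h1 : B (X.1 u) v = B (X.1 u) (v - periodProj B z v) := by
      have h2 : B (periodProj B z v) (X.1 u) = 0 :=
        (LinearMap.BilinForm.mem_orthogonal_iff.mp (hX.1 u hu)) _ (periodProj_mem z v)
      have h3 : B (X.1 u) (periodProj B z v) = 0 := (hB.eq _ _).symm.trans h2
      rw [map_sub, h3, sub_zero]
    rw [h1, ← sub_periodProj_norm hB hz hv]
    exact sq_le_mul_of_nonpos hB (nonpos_of_mem_orthogonal hB hpos hz) (hX.1 u hu) hq
  have h1 := key _ (mem_periodPlane.mpr ⟨1, 0, by simp⟩ : rePart z ∈ periodPlane z)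
  have h2 := key _ (mem_periodPlane.mpr ⟨0, 1, by simp⟩ : imPart z ∈ periodPlane z)
  rw [trace_sq_of_mem_cartanComplement hB hz hX]
  linarith

/-- If z.v = 0, then `v` is an isotropic vector of the seminegative space P^⊥, so Cauchy-Schwarz
makes it orthogonal to P^⊥, and then to everything. This keeps the logarithm of |z.v|² finite. -/
theorem pos_of_isotropic (hB : B.IsSymm) (hpos : AtMostTwoPositive B) {z : Cx V}
    (hz : z ∈ periodCone B) {v x : V} (hv : B v v = 0) (hx : B x v ≠ 0) :
    0 < B (rePart z) v ^ 2 + B (imPart z) v ^ 2 := by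
  by_contra hle
  have h1 : B (rePart z) v = 0 := by nlinarith [sq_nonneg (B (rePart z) v), sq_nonneg (B (imPart z) v)]
  have h2 : B (imPart z) v = 0 := by nlinarith [sq_nonneg (B (rePart z) v), sq_nonneg (B (imPart z) v)]
  have hvm : v ∈ B.orthogonal (periodPlane z) := mem_orthogonal_periodPlane.mpr ⟨h1, h2⟩
  have h3 := sq_le_mul_of_nonpos hB (nonpos_of_mem_orthogonal hB hpos hz)
    (sub_periodProj_mem hB hz x) hvm
  have h4 : B (periodProj B z x) v = 0 := by simp [periodProj_apply, h1, h2]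
  rw [hv, mul_zero, map_sub, LinearMap.sub_apply, h4, sub_zero] at h3
  exact hx (by nlinarith [sq_nonneg (B x v)])

end CartanComplement

/-! ### Calculus of curves tested on linear coordinates -/

section Curves

variable {W : Type u} [AddCommGroup W] [Module ℝ W]

theorem CurveHasDerivWithinAt.map {W' : Type u} [AddCommGroup W'] [Module ℝ W'] (L : W →ₗ[ℝ] W')
    {f : ℝ → W} {w : W} {s : Set ℝ} {t : ℝ} (hf : CurveHasDerivWithinAt f w s t) :
    CurveHasDerivWithinAt (fun r => L (f r)) (L w) s t :=
  fun φ => hf (φ ∘ₗ L)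

theorem CurveContinuousOn.map {W' : Type u} [AddCommGroup W'] [Module ℝ W'] (L : W →ₗ[ℝ] W')
    {f : ℝ → W} {s : Set ℝ} (hf : CurveContinuousOn f s) :
    CurveContinuousOn (fun r => L (f r)) s :=
  fun φ => hf (φ ∘ₗ L)

/-- Regularity of curves is known only through linear functionals; this expansion reduces bilinear
expressions to products of two such functionals. -/
theorem bilin_eq_sum_coord [FiniteDimensional ℝ W] (β : LinearMap.BilinForm ℝ W) (x y : W) :
    β x y = ∑ i, (Module.finBasis ℝ W).coord i x * β (Module.finBasis ℝ W i) y := by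
  have h := congrArg (fun w => β w y) ((Module.finBasis ℝ W).sum_repr x)
  simp only [map_sum, LinearMap.sum_apply, map_smul, LinearMap.smul_apply, smul_eq_mul] at h
  exact h.symm

theorem CurveHasDerivWithinAt.bilin [FiniteDimensional ℝ W] (β : LinearMap.BilinForm ℝ W)
    {f g : ℝ → W} {f' g' : W} {s : Set ℝ} {t : ℝ} (hf : CurveHasDerivWithinAt f f' s t)
    (hg : CurveHasDerivWithinAt g g' s t) :
    HasDerivWithinAt (fun r => β (f r) (g r)) (β f' (g t) + β (f t) g') s t := by
  rw [funext fun r => bilin_eq_sum_coord β (f r) (g r), bilin_eq_sum_coord β f',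
    bilin_eq_sum_coord β (f t), ← Finset.sum_add_distrib]
  exact HasDerivWithinAt.fun_sum fun i _ => (hf _).mul (hg _)

theorem CurveContinuousOn.bilin [FiniteDimensional ℝ W] (β : LinearMap.BilinForm ℝ W)
    {f g : ℝ → W} {s : Set ℝ} (hf : CurveContinuousOn f s) (hg : CurveContinuousOn g s) :
    ContinuousOn (fun r => β (f r) (g r)) s := by
  rw [funext fun r => bilin_eq_sum_coord β (f r) (g r)]
  exact continuousOn_finsetSum _ fun i _ => (hf _).mul (hg _)

end Curves

/-! ### The Busemann function as a calibration -/

section Busemann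

variable {V : Type u} [AddCommGroup V] [Module ℝ V] {B : LinearMap.BilinForm ℝ V}

/-- The Busemann function `[z] ↦ log (z.z̄ / |z.v|²)` at the cusp of an isotropic vector `v`, as a
function on the period cone. -/
def busemann (B : LinearMap.BilinForm ℝ V) (v : V) (z : Cx V) : ℝ :=
  Real.log (B (rePart z) (rePart z)) - Real.log (B (rePart z) v ^ 2 + B (imPart z) v ^ 2)

/-- The derivative of `busemann` at `z` in the direction `ξ`. -/
def busemannDeriv (B : LinearMap.BilinForm ℝ V) (v : V) (z ξ : Cx V) : ℝ :=
  2 * B (rePart z) (rePart ξ) / B (rePart z) (rePart z) -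
    2 * (B (rePart z) v * B (rePart ξ) v + B (imPart z) v * B (imPart ξ) v) /
      (B (rePart z) v ^ 2 + B (imPart z) v ^ 2)

/-- Both logarithms grow by log |c|². Hence the value depends only on the point of projective space,
and the lifts chosen by different paths can be compared. -/
theorem busemann_smul (hB : B.IsSymm) {z : Cx V} (hz : z ∈ periodCone B) {v : V}
    (hv : 0 < B (rePart z) v ^ 2 + B (imPart z) v ^ 2) {c : ℂ} (hc : c ≠ 0) :
    busemann B v (c • z) = busemann B v z := by
  obtain ⟨h1, h2, h3⟩ := (mem_periodCone_iff hB).mp hz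
  have h4 : B (imPart z) (rePart z) = 0 := (hB.eq _ _).symm.trans h1
  have hc' : 0 < c.re * c.re + c.im * c.im := Complex.normSq_pos.mpr hc
  have h5 : c • z = ofReIm (c.re • rePart z - c.im • imPart z)
      (c.re • imPart z + c.im • rePart z) := by
    rw [← smul_ofReIm, ofReIm_rePart_imPart]
  rw [busemann, busemann, h5]
  simp only [rePart_ofReIm, imPart_ofReIm, map_add, map_sub, map_smul, LinearMap.add_apply,
    LinearMap.sub_apply, LinearMap.smul_apply, smul_eq_mul, h1, h2, h4]
  have e2 : (c.re * B (rePart z) v - c.im * B (imPart z) v) ^ 2 +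
      (c.re * B (imPart z) v + c.im * B (rePart z) v) ^ 2 =
      (c.re * c.re + c.im * c.im) * (B (rePart z) v ^ 2 + B (imPart z) v ^ 2) := by ring
  have e1 : c.re * (c.re * B (rePart z) (rePart z) - c.im * 0) -
      c.im * (c.re * 0 - c.im * B (rePart z) (rePart z)) =
      (c.re * c.re + c.im * c.im) * B (rePart z) (rePart z) := by ring
  rw [e1, e2, Real.log_mul hc'.ne' h3.ne', Real.log_mul hc'.ne' hv.ne']
  ring

theorem hasDerivWithinAt_busemann [FiniteDimensional ℝ V] (hB : B.IsSymm) {v : V} {ζ : ℝ → Cx V}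
    {ξ : Cx V} {s : Set ℝ} {t : ℝ} (hζ : CurveHasDerivWithinAt ζ ξ s t) (hz : ζ t ∈ periodCone B)
    (hv : 0 < B (rePart (ζ t)) v ^ 2 + B (imPart (ζ t)) v ^ 2) :
    HasDerivWithinAt (fun r => busemann B v (ζ r)) (busemannDeriv B v (ζ t) ξ) s t := by
  obtain ⟨h1, h2, h3⟩ := (mem_periodCone_iff hB).mp hz
  have d1 := (hζ.map rePart).bilin B (hζ.map rePart)
  have d2 : HasDerivWithinAt (fun r => B (rePart (ζ r)) v) (B (rePart ξ) v) s t :=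
    hζ (B.flip v ∘ₗ rePart)
  have d3 : HasDerivWithinAt (fun r => B (imPart (ζ r)) v) (B (imPart ξ) v) s t :=
    hζ (B.flip v ∘ₗ imPart)
  have h4 : B (rePart ξ) (rePart (ζ t)) = B (rePart (ζ t)) (rePart ξ) := hB.eq _ _
  refine ((d1.log h3.ne').sub (((d2.pow 2).add (d3.pow 2)).log hv.ne')).congr_deriv ?_
  rw [busemannDeriv, h4]
  simp
  ring

attribute [local instance 100] LieRing.ofAssociativeRing

/-- The speed of the geodesics that run into the cusps of isotropic vectors. -/
def cuspSpeed (V : Type u) [AddCommGroup V] [Module ℝ V] : ℝ :=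
  Real.sqrt (2 * (Module.finrank ℝ V - 2))

theorem cuspSpeed_pos (hn : 2 < Module.finrank ℝ V) : 0 < cuspSpeed V := by
  have : (2 : ℝ) < Module.finrank ℝ V := by exact_mod_cast hn
  exact Real.sqrt_pos.mpr (by linarith)

theorem cuspSpeed_sq (hn : 2 < Module.finrank ℝ V) :
    cuspSpeed V ^ 2 = 2 * (Module.finrank ℝ V - 2) := by
  have : (2 : ℝ) < Module.finrank ℝ V := by exact_mod_cast hn
  exact Real.sq_sqrt (by linarith)

/-- The Busemann function is Lipschitz. -/
theorem busemannDeriv_le_tangentNorm [FiniteDimensional ℝ V] (hB : B.IsSymm)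
    (hB' : B.Nondegenerate) (hpos : AtMostTwoPositive B) (hn : 2 < Module.finrank ℝ V) {z : Cx V}
    (hz : z ∈ periodCone B) {v x : V} (hv : B v v = 0) (hx : B x v ≠ 0) (ξ : Cx V) :
    ENNReal.ofReal (cuspSpeed V / 2 * |busemannDeriv B v z ξ|) ≤ tangentNorm B z ξ := by
  refine le_iInf₂ fun X hX => ENNReal.ofReal_le_ofReal (Real.le_sqrt_of_sq_le ?_)
  obtain ⟨hX, hXξ⟩ := hX
  obtain ⟨c, hc⟩ := Submodule.mem_span_singleton.mp hXξ
  obtain ⟨h1, h2, h3⟩ := (mem_periodCone_iff hB).mp hz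
  have hS := pos_of_isotropic hB hpos hz hv hx
  -- The tangent vector is X z up to a complex multiple of z, and that multiple drops out of the
  -- derivative of a scale-invariant function.
  have hξ : ξ = ofReIm (X.1 (rePart z) - (c.re • rePart z - c.im • imPart z))
      (X.1 (imPart z) - (c.re • imPart z + c.im • rePart z)) := by
    rw [← ofReIm_sub, ← smul_ofReIm, ofReIm_rePart_imPart, hc, ← baseChange_ofReIm,
      ofReIm_rePart_imPart, sub_sub_cancel]
  have h5 : B (rePart z) (X.1 (rePart z)) = 0 :=
    (mem_orthogonal_periodPlane.mp (hX.1 _ (mem_periodPlane.mpr ⟨1, 0, by simp⟩))).1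
  have hD : busemannDeriv B v z ξ = -2 * (B (rePart z) v * B (X.1 (rePart z)) v
      + B (imPart z) v * B (X.1 (imPart z)) v) / (B (rePart z) v ^ 2 + B (imPart z) v ^ 2) := by
    have h3' := h3.ne'
    have hS' := hS.ne'
    rw [busemannDeriv, hξ]
    simp only [rePart_ofReIm, imPart_ofReIm, map_add, map_sub, map_smul, LinearMap.add_apply,
      LinearMap.sub_apply, LinearMap.smul_apply, smul_eq_mul, h1, h5]
    field_simp
    ring
  have hle := sq_add_sq_le_of_mem_cartanComplement hB hpos hz hX hv
  have hD2 : busemannDeriv B v z ξ ^ 2 ≤ 2 * LinearMap.trace ℝ V (X.1 * X.1) := by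
    rw [hD, div_pow, div_le_iff₀ (by positivity)]
    -- The square is the defect in Lagrange's identity, that is, Cauchy-Schwarz in the plane for the
    -- pairs formed by z.v and (X z).v.
    nlinarith [sq_nonneg (B (rePart z) v * B (X.1 (imPart z)) v
      - B (imPart z) v * B (X.1 (rePart z)) v), mul_le_mul_of_nonneg_left hle hS.le]
  have hn' : (2 : ℝ) < Module.finrank ℝ V := by exact_mod_cast hn
  rw [killingForm_soLie hB hB', mul_pow, sq_abs, div_pow, cuspSpeed_sq hn]
  nlinarith [mul_le_mul_of_nonneg_left hD2 (by linarith : (0 : ℝ) ≤ Module.finrank ℝ V - 2)]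

/-- The Busemann function bounds lengths of paths from below. -/
theorem le_length [FiniteDimensional ℝ V] (hB : B.IsSymm)
    (hB' : B.Nondegenerate) (hpos : AtMostTwoPositive B) (hn : 2 < Module.finrank ℝ V)
    {v x : V} (hv : B v v = 0) (hx : B x v ≠ 0) {p q : ℙ ℂ (Cx V)} (γ : C1Path B p q) :
    ENNReal.ofReal (cuspSpeed V / 2 * |busemann B v (γ.ζ 1) - busemann B v (γ.ζ 0)|) ≤
      γ.length := by
  have hS : ∀ t ∈ Set.Icc (0 : ℝ) 1,
      0 < B (rePart (γ.ζ t)) v ^ 2 + B (imPart (γ.ζ t)) v ^ 2 :=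
    fun t ht => pos_of_isotropic hB hpos (γ.mem t ht) hv hx
  have hP : ∀ t ∈ Set.Icc (0 : ℝ) 1, 0 < B (rePart (γ.ζ t)) (rePart (γ.ζ t)) :=
    fun t ht => ((mem_periodCone_iff hB).mp (γ.mem t ht)).2.2
  have hd : ∀ t ∈ Set.Icc (0 : ℝ) 1, HasDerivWithinAt (fun r => busemann B v (γ.ζ r))
      (busemannDeriv B v (γ.ζ t) (γ.ζ' t)) (Set.Icc 0 1) t :=
    fun t ht => hasDerivWithinAt_busemann hB (γ.deriv t ht) (γ.mem t ht) (hS t ht)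
  have hc : CurveContinuousOn γ.ζ (Set.Icc 0 1) := fun φ => (γ.contDiff φ).continuousOn
  -- The field `ζ'` is given only pointwise, but uniqueness of derivatives on [0, 1] identifies its
  -- coordinates with the continuous derivatives of a C¹ function. This provides integrability for
  -- the fundamental theorem of calculus.
  have hc' : CurveContinuousOn γ.ζ' (Set.Icc 0 1) := fun φ =>
    ((γ.contDiff φ).continuousOn_derivWithin (uniqueDiffOn_Icc one_pos) le_rfl).congr
      fun t ht => ((γ.deriv t ht φ).derivWithin (uniqueDiffOn_Icc one_pos t ht)).symm
  have c1 : ContinuousOn (fun r => B (rePart (γ.ζ r)) v) (Set.Icc 0 1) := hc (B.flip v ∘ₗ rePart)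
  have c2 : ContinuousOn (fun r => B (imPart (γ.ζ r)) v) (Set.Icc 0 1) := hc (B.flip v ∘ₗ imPart)
  have c1' : ContinuousOn (fun r => B (rePart (γ.ζ' r)) v) (Set.Icc 0 1) :=
    hc' (B.flip v ∘ₗ rePart)
  have c2' : ContinuousOn (fun r => B (imPart (γ.ζ' r)) v) (Set.Icc 0 1) :=
    hc' (B.flip v ∘ₗ imPart)
  have hcont : ContinuousOn (fun t => busemannDeriv B v (γ.ζ t) (γ.ζ' t)) (Set.Icc 0 1) := by
    refine ContinuousOn.sub (ContinuousOn.div ?_ ?_ fun t ht => (hP t ht).ne')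
      (ContinuousOn.div ?_ ?_ fun t ht => (hS t ht).ne')
    · exact continuousOn_const.mul ((hc.map rePart).bilin B (hc'.map rePart))
    · exact (hc.map rePart).bilin B (hc.map rePart)
    · exact continuousOn_const.mul ((c1.mul c1').add (c2.mul c2'))
    · exact (c1.pow 2).add (c2.pow 2)
  have hint : ∫ t in (0 : ℝ)..1, busemannDeriv B v (γ.ζ t) (γ.ζ' t)
      = busemann B v (γ.ζ 1) - busemann B v (γ.ζ 0) :=
    intervalIntegral.integral_eq_sub_of_hasDerivAt_of_le zero_le_one
      (fun t ht => (hd t ht).continuousWithinAt)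
      (fun t ht => (hd t (Set.Ioo_subset_Icc_self ht)).hasDerivAt (Icc_mem_nhds ht.1 ht.2))
      (ContinuousOn.intervalIntegrable (by rwa [Set.uIcc_of_le zero_le_one]))
  have hk := cuspSpeed_pos (V := V) hn
  calc ENNReal.ofReal (cuspSpeed V / 2 * |busemann B v (γ.ζ 1) - busemann B v (γ.ζ 0)|)
      = ENNReal.ofReal (cuspSpeed V / 2) *
          ‖∫ t in Set.Ioc (0 : ℝ) 1, busemannDeriv B v (γ.ζ t) (γ.ζ' t)‖ₑ := by
        rw [← hint, intervalIntegral.integral_of_le zero_le_one,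
          ENNReal.ofReal_mul (by positivity), ← Real.norm_eq_abs, ofReal_norm]
    _ ≤ ENNReal.ofReal (cuspSpeed V / 2) *
          ∫⁻ t in Set.Icc (0 : ℝ) 1, ‖busemannDeriv B v (γ.ζ t) (γ.ζ' t)‖ₑ := by
        gcongr
        exact (MeasureTheory.enorm_integral_le_lintegral_enorm _).trans
          (MeasureTheory.lintegral_mono_set Set.Ioc_subset_Icc_self)
    _ = ∫⁻ t in Set.Icc (0 : ℝ) 1,
          ENNReal.ofReal (cuspSpeed V / 2 * |busemannDeriv B v (γ.ζ t) (γ.ζ' t)|) := by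
        rw [← MeasureTheory.lintegral_const_mul' _ _ ENNReal.ofReal_ne_top]
        refine MeasureTheory.lintegral_congr fun t => ?_
        rw [ENNReal.ofReal_mul (by positivity), ← Real.norm_eq_abs, ofReal_norm]
    _ ≤ γ.length := MeasureTheory.setLIntegral_mono' measurableSet_Icc fun t ht =>
        busemannDeriv_le_tangentNorm hB hB' hpos hn (γ.mem t ht) hv hx _

end Busemann

/-! ### Linear paths in the tube domain as orbits of boosts -/

section TubeGeodesic

variable {V : Type u} [AddCommGroup V] [Module ℝ V] {B : LinearMap.BilinForm ℝ V}

theorem Represents.exists_smul {p : ℙ ℂ (Cx V)} {z w : Cx V} (hz : Represents p z)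
    (hw : Represents p w) : ∃ c : ℂ, c ≠ 0 ∧ z = c • w := by
  obtain ⟨hz0, rfl⟩ := hz
  obtain ⟨hw0, h⟩ := hw
  obtain ⟨c, hc⟩ := (Projectivization.mk_eq_mk_iff' ℂ _ _ hw0 hz0).mp h
  have hc0 : c ≠ 0 := by rintro rfl; exact hw0 (by rw [← hc, zero_smul])
  exact ⟨c⁻¹, inv_ne_zero hc0, by rw [← hc, smul_smul, inv_mul_cancel₀ hc0, one_smul]⟩

theorem Represents.mem_periodDomain (hB : B.IsSymm) {p : ℙ ℂ (Cx V)} {z : Cx V}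
    (hz : Represents p z) (hz' : z ∈ periodCone B) : p ∈ periodDomain B := by
  obtain ⟨c, hc, h⟩ := Represents.exists_smul (z := p.rep) ⟨p.rep_nonzero, p.mk_rep⟩ hz
  change p.rep ∈ periodCone B
  rw [h]
  exact smul_mem_periodCone hB hz' hc

theorem coe_smul_cx (l : ℝ) (z : Cx V) : (l : ℂ) • z = l • z := by
  rw [← ofReIm_rePart_imPart z, smul_ofReIm, real_smul_ofReIm]
  simp

/-- Vectors `x`, `y` over a point of the tube domain of `v`, chosen such that `x` is isotropic and
orthogonal to `y`. -/
structure IsTubeFrame (B : LinearMap.BilinForm ℝ V) (v x y : V) : Prop where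
  v_v : B v v = 0
  x_v : B x v = -1
  v_x : B v x = -1
  y_v : B y v = 0
  v_y : B v y = 0
  x_x : B x x = 0
  x_y : B x y = 0
  y_x : B y x = 0
  y_y : 0 < B y y

theorem TubeDomain.exists_isTubeFrame (hB : B.IsSymm) {v : V} (τ : TubeDomain B v) :
    ∃ x y, IsTubeFrame B v x y ∧ Submodule.Quotient.mk x = τ.x ∧ Submodule.Quotient.mk y = τ.y := by
  have hs : ∀ a b, B a b = B b a := fun a b => hB.eq a b
  have hmk : ∀ (a : V) (r : ℝ), Submodule.Quotient.mk (p := Submodule.span ℝ {v}) (a + r • v)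
      = Submodule.Quotient.mk a := fun a r => by
    rw [Submodule.Quotient.eq, add_sub_cancel_left]
    exact Submodule.smul_mem _ _ (Submodule.mem_span_singleton_self v)
  obtain ⟨x₀, hx₀⟩ := Submodule.Quotient.mk_surjective _ τ.x
  obtain ⟨y₀, hy₀⟩ := Submodule.Quotient.mk_surjective _ τ.y
  -- Because x₀.v = -1, adding c v changes the norm of x₀ by -2c and the product y₀.x by -c when
  -- added to y₀; the coefficients here and below make both vanish.
  have hx : Submodule.Quotient.mk (x₀ + (B x₀ x₀ / 2) • v) = τ.x := (hmk _ _).trans hx₀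
  set x := x₀ + (B x₀ x₀ / 2) • v with hxdef
  have hy : Submodule.Quotient.mk (y₀ + B y₀ x • v) = τ.y := (hmk _ _).trans hy₀
  set y := y₀ + B y₀ x • v with hydef
  have vv := τ.isotropic
  have xv := τ.x_mem x hx
  have yv := τ.y_mem y hy
  have xx : B x x = 0 := by
    have h1 := τ.x_mem x₀ hx₀
    have h2 : B v x₀ = -1 := (hs _ _).trans h1
    simp only [hxdef, map_add, map_smul, LinearMap.add_apply, LinearMap.smul_apply, smul_eq_mul, h1,
      h2, vv]
    ring
  have yx : B y x = 0 := by
    have h1 : B v x = -1 := (hs _ _).trans xv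
    rw [hydef, LinearMap.map_add₂, LinearMap.map_smul₂, smul_eq_mul, h1]
    ring
  exact ⟨x, y, ⟨vv, xv, (hs _ _).trans xv, yv, (hs _ _).trans yv, xx, (hs _ _).trans yx, yx,
    τ.y_pos y hy⟩, hx, hy⟩

/-- The vector `z` with `z.z = 0` over `x + i r y`, for a tube frame `x`, `y`. -/
def tubeLift (B : LinearMap.BilinForm ℝ V) (v x y : V) (r : ℝ) : Cx V :=
  ofReIm (x - (r ^ 2 * (B y y / 2)) • v) (r • y)

theorem tubeVec_scale_eq_tubeLift (hB : B.IsSymm) {v x y : V} (h : IsTubeFrame B v x y)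
    {τ : TubeDomain B v} (hx : Submodule.Quotient.mk x = τ.x) (hy : Submodule.Quotient.mk y = τ.y)
    {r : ℝ} (hr : 0 < r) : tubeVec (τ.scale r hr) = tubeLift B v x y r := by
  have hy' : Submodule.Quotient.mk (r • y) = (τ.scale r hr).y := by
    rw [Submodule.Quotient.mk_smul, hy]
    rfl
  refine ((tubeVec_unique hB (τ.scale r hr) x (r • y) hx hy' _).mp ⟨?_, ?_⟩).symm
  · simp only [tubeLift, cform_ofReIm, map_sub, map_smul, LinearMap.sub_apply,
      LinearMap.smul_apply, smul_eq_mul, h.v_v, h.x_v, h.v_x, h.x_x, h.x_y, h.y_x, h.v_y, h.y_v]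
    simp
    ring
  · rw [tubeLift, ofReIm_sub, sub_self, Submodule.mem_span_singleton]
    refine ⟨((-(r ^ 2 * (B y y / 2)) : ℝ) : ℂ), ?_⟩
    have h1 : (1 : ℂ) ⊗ₜ[ℝ] v = ofReIm v 0 := by simp [ofReIm]
    rw [h1, smul_ofReIm, Complex.ofReal_re, Complex.ofReal_im]
    congr 1
    · rw [zero_smul, sub_zero, neg_smul]; abel
    · simp

theorem tubeLift_mem_periodCone (hB : B.IsSymm) {v x y : V} (h : IsTubeFrame B v x y)
    {r : ℝ} (hr : 0 < r) : tubeLift B v x y r ∈ periodCone B := by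
  rw [mem_periodCone_iff hB]
  simp only [tubeLift, rePart_ofReIm, imPart_ofReIm, map_sub, map_smul, LinearMap.sub_apply,
      LinearMap.smul_apply, smul_eq_mul, h.v_v, h.x_v, h.v_x, h.x_x, h.x_y, h.v_y]
  refine ⟨by ring, by ring, ?_⟩
  have := mul_pos (pow_pos hr 2) h.y_y
  linarith

/-- The vectors x, v span a hyperbolic plane, and y is a non-isotropic vector orthogonal to it. This
makes the speed positive. -/
theorem IsTubeFrame.two_lt_finrank [FiniteDimensional ℝ V] {v x y : V}
    (h : IsTubeFrame B v x y) : 2 < Module.finrank ℝ V := by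
  have hli : LinearIndependent ℝ ![x, v, y] := by
    rw [Fintype.linearIndependent_iff]
    intro g hg
    simp only [Fin.sum_univ_three, Matrix.cons_val_zero, Matrix.cons_val_one,
      Matrix.cons_val] at hg
    have h1 := congrArg (B x) hg
    have h2 := congrArg (B v) hg
    have h3 := congrArg (B y) hg
    simp only [map_add, map_smul, smul_eq_mul, map_zero, h.v_v, h.x_v, h.v_x, h.x_x, h.x_y, h.y_x,
      h.v_y, h.y_v] at h1 h2 h3
    have h4 : g 2 = 0 := by
      have : g 2 * B y y = 0 := by linarith
      exact (mul_eq_zero.mp this).resolve_right h.y_y.ne'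
    intro i
    fin_cases i
    · change g 0 = 0; linarith
    · change g 1 = 0; linarith
    · exact h4
  have hcard := hli.fintype_card_le_finrank
  rwa [Fintype.card_fin] at hcard

/-- Here |z.v| = 1 all along the curve, and Re z has norm e^{2t} (y.y). -/
theorem busemann_tubeLift {v x y : V} (h : IsTubeFrame B v x y) (t : ℝ) :
    busemann B v (tubeLift B v x y (Real.exp t)) = 2 * t + Real.log (B y y) := by
  simp only [busemann, tubeLift, rePart_ofReIm, imPart_ofReIm, map_sub, map_smul,
    LinearMap.sub_apply, LinearMap.smul_apply, smul_eq_mul, h.v_v, h.x_v, h.v_x, h.x_x, h.y_v]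
  have e1 : (-1 - Real.exp t ^ 2 * (B y y / 2) * 0) ^ 2 + (Real.exp t * 0) ^ 2 = 1 := by ring
  rw [e1]
  convert_to Real.log (Real.exp t ^ 2 * B y y) - Real.log 1 = _
  · congr 2
    ring
  rw [Real.log_one, sub_zero, Real.log_mul (by positivity) h.y_y.ne', Real.log_pow, Real.log_exp]
  norm_num

/-- The derivative of `tubeLift` along `r = exp t`. -/
def tubeLiftDeriv (B : LinearMap.BilinForm ℝ V) (v y : V) (r : ℝ) : Cx V :=
  ofReIm (-(2 * r ^ 2 * (B y y / 2)) • v) (r • y)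

theorem dual_tubeLift (φ : Module.Dual ℝ (Cx V)) (v x y : V) (r : ℝ) :
    φ (tubeLift B v x y r) =
      φ (ofReIm x 0) - r ^ 2 * (B y y / 2) * φ (ofReIm v 0) + r * φ (ofReIm 0 y) := by
  have h1 : tubeLift B v x y r = ofReIm x 0 - (r ^ 2 * (B y y / 2)) • ofReIm v 0
      + r • ofReIm 0 y := by
    rw [real_smul_ofReIm, real_smul_ofReIm, ofReIm_sub, ofReIm_add]
    simp [tubeLift]
  simp only [h1, map_add, map_sub, map_smul, smul_eq_mul]

theorem dual_tubeLiftDeriv (φ : Module.Dual ℝ (Cx V)) (v y : V) (r : ℝ) :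
    φ (tubeLiftDeriv B v y r) =
      -(2 * r ^ 2 * (B y y / 2)) * φ (ofReIm v 0) + r * φ (ofReIm 0 y) := by
  have h1 : tubeLiftDeriv B v y r = (-(2 * r ^ 2 * (B y y / 2))) • ofReIm v 0
      + r • ofReIm 0 y := by
    rw [real_smul_ofReIm, real_smul_ofReIm, ofReIm_add]
    simp [tubeLiftDeriv]
  simp only [h1, map_add, map_smul, smul_eq_mul]

theorem hasDerivAt_dual_tubeLift (φ : Module.Dual ℝ (Cx V)) (v x y : V) (t : ℝ) :
    HasDerivAt (fun t => φ (tubeLift B v x y (Real.exp t)))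
      (φ (tubeLiftDeriv B v y (Real.exp t))) t := by
  simp only [dual_tubeLift, dual_tubeLiftDeriv]
  have h := Real.hasDerivAt_exp t
  refine ((((h.fun_pow 2).mul_const (B y y / 2)).mul_const (φ (ofReIm v 0))).const_sub
    (φ (ofReIm x 0)) |>.add (h.mul_const (φ (ofReIm 0 y)))).congr_deriv ?_
  simp only [Nat.cast_ofNat, Nat.add_one_sub_one, pow_one]
  ring

theorem contDiff_dual_tubeLift (φ : Module.Dual ℝ (Cx V)) (v x y : V) :
    ContDiff ℝ ∞ (fun t => φ (tubeLift B v x y (Real.exp t))) := by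
  simp only [dual_tubeLift]
  fun_prop

attribute [local instance 100] LieRing.ofAssociativeRing

/-- The generator `u ↦ (u.v) x - (u.x) v` of the one-parameter group of boosts of the hyperbolic
plane spanned by `x` and `v`. -/
def boost (hB : B.IsSymm) (v x : V) : soLie B :=
  ⟨(B.flip v).smulRight x - (B.flip x).smulRight v, by
    rw [mem_soLie_iff]
    intro u w
    have h1 : B x w = B w x := hB.eq _ _
    have h2 : B v w = B w v := hB.eq _ _
    simp [h1, h2]
    ring⟩

theorem boost_apply (hB : B.IsSymm) (v x u : V) : (boost hB v x).1 u = B u v • x - B u x • v := rfl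

/-- The boost kills y, negates x and fixes v. So it sends Re z = x - c v to -(x + c v), which is
orthogonal to both Re z and y. -/
theorem boost_mem_cartanComplement (hB : B.IsSymm) {v x y : V} (h : IsTubeFrame B v x y)
    (r : ℝ) : boost hB v x ∈ cartanComplement B (tubeLift B v x y r) := by
  refine ⟨fun p hp => ?_, fun q hq => ?_⟩
  · obtain ⟨α, β, rfl⟩ := mem_periodPlane.mp hp
    rw [mem_orthogonal_periodPlane]
    simp only [tubeLift, rePart_ofReIm, imPart_ofReIm, boost_apply, map_add, map_sub, map_smul,
      LinearMap.sub_apply, LinearMap.smul_apply, smul_eq_mul, h.v_v, h.x_v,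
      h.v_x, h.x_x, h.y_x, h.y_v]
    constructor <;> ring
  · obtain ⟨h1, -⟩ := mem_orthogonal_periodPlane.mp hq
    have h3 : B q x = B x q := hB.eq _ _
    have h4 : B q v = B v q := hB.eq _ _
    rw [tubeLift, rePart_ofReIm, map_sub, map_smul, LinearMap.sub_apply, LinearMap.smul_apply,
      smul_eq_mul, sub_eq_zero] at h1
    rw [mem_periodPlane]
    -- Orthogonality to Re z = x - c v says q.x = c (q.v), so the image of q is (q.v)(x - c v).
    refine ⟨B q v, 0, ?_⟩
    rw [boost_apply, tubeLift, rePart_ofReIm, h3, h4, h1]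
    module

/-- The eigenvalues are -1 on x, 1 on v and 0 on the complement of their plane. The trace does not
involve r, so the formula for 𝔪_P may be evaluated at r = 1. -/
theorem trace_boost_sq [FiniteDimensional ℝ V] (hB : B.IsSymm) {v x y : V}
    (h : IsTubeFrame B v x y) :
    LinearMap.trace ℝ V ((boost hB v x).1 * (boost hB v x).1) = 2 := by
  have hz := tubeLift_mem_periodCone hB h one_pos
  rw [trace_sq_of_mem_cartanComplement hB hz (boost_mem_cartanComplement hB h 1)]
  have hy := h.y_y.ne'
  simp only [tubeLift, rePart_ofReIm, imPart_ofReIm, boost_apply, map_sub, map_smul,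
    LinearMap.sub_apply, LinearMap.smul_apply, smul_eq_mul, h.v_v, h.x_v,
    h.v_x, h.x_x, h.y_x, h.y_v]
  ring_nf
  field_simp

theorem boost_inducesTangent (hB : B.IsSymm) {v x y : V} (h : IsTubeFrame B v x y) (r : ℝ) :
    InducesTangent B (boost hB v x) (tubeLift B v x y r) (tubeLiftDeriv B v y r) := by
  -- The flow of the boost moves the lift at r to e^{-s} times the lift at e^s r; the factor e^{-s}
  -- accounts for the coefficient -1.
  refine Submodule.mem_span_singleton.mpr ⟨-1, ?_⟩
  rw [tubeLift, tubeLiftDeriv, baseChange_ofReIm, ofReIm_sub, smul_ofReIm]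
  simp only [boost_apply, map_sub, map_smul, h.v_v, h.x_v, h.v_x, h.x_x, h.y_x, h.y_v]
  congr 1
  · simp; module
  · simp

/-- A multiple of the boost is a competitor in the infimum. The factor l serves the affine
reparametrization to [0, 1]. -/
theorem tangentNorm_tubeLift_le [FiniteDimensional ℝ V] (hB : B.IsSymm) (hB' : B.Nondegenerate)
    {v x y : V} (h : IsTubeFrame B v x y) (r l : ℝ) :
    tangentNorm B (tubeLift B v x y r) (l • tubeLiftDeriv B v y r) ≤
      ENNReal.ofReal (cuspSpeed V * |l|) := by
  have hX := boost_mem_cartanComplement hB h r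
  have hmem : l • boost hB v x ∈ cartanComplement B (tubeLift B v x y r) :=
    ⟨fun p hp => Submodule.smul_mem _ l (hX.1 p hp), fun q hq => Submodule.smul_mem _ l (hX.2 q hq)⟩
  have hind : InducesTangent B (l • boost hB v x) (tubeLift B v x y r)
      (l • tubeLiftDeriv B v y r) := by
    have h1 := Submodule.smul_mem _ (l : ℂ) (boost_inducesTangent hB h r)
    have h2 : LinearMap.baseChange ℂ (l • boost hB v x).1 (tubeLift B v x y r)
        = (l : ℂ) • LinearMap.baseChange ℂ (boost hB v x).1 (tubeLift B v x y r) := by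
      rw [coe_smul_cx]
      change LinearMap.baseChange ℂ (l • (boost hB v x).1) _ = _
      rw [LinearMap.baseChange_smul]
      rfl
    rw [InducesTangent, h2, ← coe_smul_cx, ← smul_sub]
    exact h1
  refine (iInf₂_le (l • boost hB v x) ⟨hmem, hind⟩).trans (le_of_eq ?_)
  rw [map_smul, map_smul, LinearMap.smul_apply, killingForm_soLie hB hB', trace_boost_sq hB h,
    smul_eq_mul, smul_eq_mul, cuspSpeed, ← mul_assoc, mul_comm _ (2 : ℝ),
    Real.sqrt_mul' _ (by have : (2 : ℝ) < Module.finrank ℝ V := by exact_mod_cast h.two_lt_finrank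
                         linarith),
    Real.sqrt_mul_self_eq_abs, mul_comm]

/-- The lower bound comes from the calibration, whose derivative along the curve is 2; so uniqueness
of the inducing element of 𝔪_P need not be shown. -/
theorem tangentNorm_tubeLift [FiniteDimensional ℝ V] (hB : B.IsSymm) (hB' : B.Nondegenerate)
    (hpos : AtMostTwoPositive B) {v x y : V} (h : IsTubeFrame B v x y) {r : ℝ} (hr : 0 < r) :
    tangentNorm B (tubeLift B v x y r) (tubeLiftDeriv B v y r) = ENNReal.ofReal (cuspSpeed V) := by
  apply le_antisymm
  · simpa using tangentNorm_tubeLift_le hB hB' h r 1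
  · have h1 := busemannDeriv_le_tangentNorm hB hB' hpos h.two_lt_finrank
      (tubeLift_mem_periodCone hB h hr) h.v_v (x := x) (by rw [h.x_v]; norm_num)
      (tubeLiftDeriv B v y r)
    have h2 : busemannDeriv B v (tubeLift B v x y r) (tubeLiftDeriv B v y r) = 2 := by
      have := h.y_y.ne'
      simp only [busemannDeriv, tubeLift, tubeLiftDeriv, rePart_ofReIm, imPart_ofReIm, map_sub,
        map_neg, neg_smul, map_smul, LinearMap.sub_apply, LinearMap.smul_apply, LinearMap.neg_apply,
        smul_eq_mul, h.v_v, h.x_v, h.v_x, h.x_x, h.y_v]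
      ring_nf
      field_simp
    rwa [h2, abs_two, div_mul_cancel₀ _ two_ne_zero] at h1

/-- The segment of the curve `tubeLift` between two parameters, as a path on `[0, 1]`. -/
def tubePath (hB : B.IsSymm) {v x y : V} (h : IsTubeFrame B v x y) (t t' : ℝ) {p q : ℙ ℂ (Cx V)}
    (hp : Represents p (tubeLift B v x y (Real.exp t)))
    (hq : Represents q (tubeLift B v x y (Real.exp t'))) : C1Path B p q where
  ζ s := tubeLift B v x y (Real.exp (t + s * (t' - t)))
  ζ' s := (t' - t) • tubeLiftDeriv B v y (Real.exp (t + s * (t' - t)))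
  contDiff φ := (((contDiff_dual_tubeLift φ v x y).of_le (by simp)).comp
    (f := fun s : ℝ => t + s * (t' - t)) (by fun_prop)).contDiffOn
  deriv s _ φ := by
    have h1 : HasDerivAt (fun s : ℝ => t + s * (t' - t)) (t' - t) s := by
      simpa using ((hasDerivAt_id s).mul_const (t' - t)).const_add t
    refine (((hasDerivAt_dual_tubeLift φ v x y _).comp s h1).congr_deriv ?_).hasDerivWithinAt
    rw [map_smul, smul_eq_mul, mul_comm]
  mem s _ := tubeLift_mem_periodCone hB h (Real.exp_pos _)
  source := by simpa using hp
  target := by simpa using hq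

theorem riemannianDist_tubeLift [FiniteDimensional ℝ V] (hB : B.IsSymm) (hB' : B.Nondegenerate)
    (hpos : AtMostTwoPositive B) {v x y : V} (h : IsTubeFrame B v x y) (t t' : ℝ)
    {p q : ℙ ℂ (Cx V)} (hp : Represents p (tubeLift B v x y (Real.exp t)))
    (hq : Represents q (tubeLift B v x y (Real.exp t'))) :
    riemannianDist B p q = ENNReal.ofReal (cuspSpeed V * |t - t'|) := by
  have hxv : B x v ≠ 0 := by rw [h.x_v]; norm_num
  apply le_antisymm
  · refine (iInf_le _ (tubePath hB h t t' hp hq)).trans ?_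
    refine (MeasureTheory.lintegral_mono fun s =>
      tangentNorm_tubeLift_le hB hB' h _ (t' - t)).trans ?_
    simp [abs_sub_comm]
  · refine le_iInf fun γ => ?_
    have hζ : ∀ {s t : ℝ} {p : ℙ ℂ (Cx V)}, Represents p (γ.ζ s) →
        Represents p (tubeLift B v x y (Real.exp t)) →
        busemann B v (γ.ζ s) = 2 * t + Real.log (B y y) := by
      intro s t p h1 h2
      obtain ⟨c, hc, hcz⟩ := h1.exists_smul h2
      have hm := tubeLift_mem_periodCone hB h (Real.exp_pos t)
      rw [hcz, busemann_smul hB hm (pos_of_isotropic hB hpos hm h.v_v hxv) hc,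
        busemann_tubeLift h]
    refine le_trans (le_of_eq ?_) (le_length hB hB' hpos h.two_lt_finrank h.v_v hxv γ)
    rw [hζ γ.source hp, hζ γ.target hq, add_sub_add_right_eq_sub, ← mul_sub, abs_mul, abs_two,
      abs_sub_comm]
    congr 1
    ring

/-- Linear paths in the tube domain, in logarithmic parametrization, are geodesics. -/
theorem isGeodesicOn_tubeExp [FiniteDimensional ℝ V] (hB : B.IsSymm) (hB' : B.Nondegenerate)
    (hpos : AtMostTwoPositive B) {v : V} (τ : TubeDomain B v) (s : Set ℝ) :
    0 < cuspSpeed V ∧ IsGeodesicOn B (fun t => tubeExp (τ.scale (Real.exp t) (Real.exp_pos t))) s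
      (cuspSpeed V) := by
  obtain ⟨x, y, h, hx, hy⟩ := τ.exists_isTubeFrame hB
  have hrep : ∀ t, Represents (tubeExp (τ.scale (Real.exp t) (Real.exp_pos t)))
      (tubeLift B v x y (Real.exp t)) := fun t => by
    rw [← tubeVec_scale_eq_tubeLift hB h hx hy (Real.exp_pos t)]
    exact ⟨tubeVec_ne_zero _, rfl⟩
  have hmem := fun t => tubeLift_mem_periodCone hB h (Real.exp_pos t)
  -- The distance formula holds for all pairs of parameters, so the radius 1 is arbitrary.
  refine ⟨cuspSpeed_pos h.two_lt_finrank, fun t _ => (hrep t).mem_periodDomain hB (hmem t), ?_,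
    fun t _ => ⟨1, one_pos, fun r _ r' _ _ _ =>
      riemannianDist_tubeLift hB hB' hpos h r r' (hrep r) (hrep r')⟩⟩
  exact ⟨fun t => tubeLift B v x y (Real.exp t), fun t => tubeLiftDeriv B v y (Real.exp t),
    fun φ => (contDiff_dual_tubeLift φ v x y).contDiffOn, fun t _ => hrep t,
    fun t _ φ => (hasDerivAt_dual_tubeLift φ v x y t).hasDerivWithinAt,
    fun t _ => tangentNorm_tubeLift hB hB' hpos h (Real.exp_pos t)⟩

end TubeGeodesic

/-! ### Consequences of the signature -/

section Signature

variable {V : Type u} [AddCommGroup V] [Module ℝ V] {B : LinearMap.BilinForm ℝ V}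

/-- Positivity forces Φ to be injective, and its range is then a positive definite subspace. -/
theorem HasSignature.finrank_le [FiniteDimensional ℝ V] {p q : ℕ} (hB : HasSignature B p q)
    {E : Type*} [AddCommGroup E] [Module ℝ E] (Φ : E →ₗ[ℝ] V)
    (hΦ : ∀ e, e ≠ 0 → 0 < B (Φ e) (Φ e)) : Module.finrank ℝ E ≤ p := by
  have hinj : Function.Injective Φ := by
    rw [← LinearMap.ker_eq_bot, LinearMap.ker_eq_bot']
    intro e he
    by_contra h0
    have := hΦ e h0
    simp [he] at this
  rw [← LinearMap.finrank_range_of_inj hinj, ← hB.2.2.1]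
  apply le_sigPos_of_posDef
  rintro ⟨_, e, rfl⟩ h0
  exact hΦ e (by rintro rfl; simp at h0)

theorem HasSignature.card_le [FiniteDimensional ℝ V] {p q : ℕ} (hB : HasSignature B p q) {k : ℕ}
    (u : Fin k → V) (hu : ∀ i j, i ≠ j → B (u i) (u j) = 0) (hu' : ∀ i, 0 < B (u i) (u i)) :
    k ≤ p := by
  have h := hB.finrank_le (Fintype.linearCombination ℝ u) fun c hc => by
    have h1 : B (Fintype.linearCombination ℝ u c) (Fintype.linearCombination ℝ u c)
        = ∑ i, c i ^ 2 * B (u i) (u i) := by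
      simp only [Fintype.linearCombination_apply, map_sum, LinearMap.sum_apply, map_smul,
        LinearMap.smul_apply, smul_eq_mul]
      refine Finset.sum_congr rfl fun i _ => ?_
      rw [Finset.sum_eq_single i (fun j _ hj => by rw [hu j i hj]; simp) (by simp)]
      ring
    rw [h1]
    obtain ⟨i, hi⟩ := Function.ne_iff.mp hc
    exact Finset.sum_pos' (fun j _ => mul_nonneg (sq_nonneg _) (hu' j).le)
      ⟨i, Finset.mem_univ i, mul_pos (sq_pos_of_ne_zero hi) (hu' i)⟩
  simpa using h

theorem HasSignature.atMostTwoPositive [FiniteDimensional ℝ V] {q : ℕ} (hB : HasSignature B 2 q) :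
    AtMostTwoPositive B := by
  intro a b c hab hac hbc ha hb
  by_contra! hc
  have hs : ∀ x y, B x y = 0 → B y x = 0 := fun x y h => (hB.1.eq y x).trans h
  have h := hB.card_le ![a, b, c]
    (by intro i j hij; fin_cases i <;> fin_cases j <;> first | exact absurd rfl hij | skip
        exacts [hab, hac, hs _ _ hab, hbc, hs _ _ hac, hs _ _ hbc])
    (by intro i; fin_cases i; exacts [ha, hb, hc])
  omega

/-- The complement of a maximal positive definite subspace is anisotropic. -/
theorem HasSignature.eq_zero_of_isotropic [FiniteDimensional ℝ V] {p q : ℕ}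
    (hB : HasSignature B p q) (u : Fin p → V) (hu : ∀ i j, i ≠ j → B (u i) (u j) = 0)
    (hu' : ∀ i, 0 < B (u i) (u i)) {w : V} (hw : B w w = 0) (hwu : ∀ i, B w (u i) = 0) :
    w = 0 := by
  have hs : ∀ x y, B x y = B y x := fun x y => hB.1.eq x y
  by_contra hw0
  obtain ⟨x, hx⟩ : ∃ x, B w x ≠ 0 := by
    by_contra! h
    exact hw0 (hB.2.1.1 w h)
  set y := x - ∑ i, (B (u i) x / B (u i) (u i)) • u i with hy
  have hwy : B w y = B w x := by simp [hy, hwu]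
  have huy : ∀ i, B (u i) y = 0 := fun i => by
    simp only [hy, map_sub, map_sum, map_smul, smul_eq_mul]
    rw [Finset.sum_eq_single i (fun j _ hj => by rw [hu i j hj.symm, mul_zero]) (by simp),
      div_mul_cancel₀ _ (hu' i).ne', sub_self]
  -- Moving y along the isotropic w changes its norm linearly, so norm 1 can be reached; the result
  -- is a further positive vector orthogonal to all the u i.
  set t := (1 - B y y) / (2 * B w x) with ht
  have hpos : B (y + t • w) (y + t • w) = 1 := by
    simp only [map_add, map_smul, LinearMap.add_apply, LinearMap.smul_apply, smul_eq_mul, hw,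
      hs y w, hwy, ht]
    field_simp
    ring
  have huyt : ∀ i, B (u i) (y + t • w) = 0 := fun i => by
    rw [map_add, map_smul, huy, hs (u i) w, hwu, smul_zero, add_zero]
  have h := hB.card_le (Fin.cons (y + t • w) u : Fin (p + 1) → V)
    (by
      intro i j
      refine Fin.cases ?_ (fun i => ?_) i <;> refine Fin.cases ?_ (fun j => ?_) j
      · intro h; exact absurd rfl h
      · intro _; rw [Fin.cons_zero, Fin.cons_succ, hs, huyt]
      · intro _; rw [Fin.cons_zero, Fin.cons_succ, huyt]
      · intro h; rw [Fin.cons_succ, Fin.cons_succ]; exact hu i j fun e => h (e ▸ rfl))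
    (by
      intro i
      refine Fin.cases ?_ (fun i => ?_) i
      · rw [Fin.cons_zero, hpos]; exact one_pos
      · rw [Fin.cons_succ]; exact hu' i)
  omega

end Signature

/-! ### Linear degenerations in quotients -/

section Degeneration

variable {N : Type u} [AddCommGroup N] [Module.Finite ℤ N] {b : LinearMap.BilinForm ℤ N}
  {p₀ : ℙ ℂ (Cx (ℝ ⊗[ℤ] N))} {Γ : Subgroup (N ≃ₗ[ℤ] N)}

/-- Linear degenerations, parametrized by `log t`, are geodesics. -/
theorem IsLinearDegeneration.isQuotientGeodesicOn (hB : (realForm b).IsSymm)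
    (hB' : (realForm b).Nondegenerate) (hpos : AtMostTwoPositive (realForm b))
    {γ : ℝ → PeriodQuotient b p₀ Γ} {v : N} (hγ : IsLinearDegeneration γ v) :
    ∃ k : ℝ, 0 < k ∧ ∃ T : ℝ, IsQuotientGeodesicOn (fun t => γ (Real.exp t)) (Set.Ioi T) k := by
  obtain ⟨f, -, τ, hτ⟩ := hγ
  obtain ⟨T, hT⟩ := Filter.eventually_atTop.mp (Real.tendsto_exp_atTop.eventually hτ)
  obtain ⟨hk, hgeo⟩ := isGeodesicOn_tubeExp hB hB' hpos τ (Set.Ioi T)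
  exact ⟨_, hk, T, _, hgeo, fun t ht => (hT t (Set.mem_Ioi.mp ht).le).2⟩

end Degeneration

/-! ### The extended Néron-Severi lattice of a K3 surface -/

namespace K3Data

variable {Λ : Type u} [AddCommGroup Λ] [Module.Free ℤ Λ] [Module.Finite ℤ Λ] (X : K3Data Λ)

/-- The component `N(X) → H⁰(X, ℤ)`. -/
def degZero : X.extNS →ₗ[ℤ] ℤ := LinearMap.fst ℤ ℤ (Λ × ℤ) ∘ₗ X.extNS.subtype

/-- The component `N(X) → H²(X, ℤ)`. -/
def degTwo : X.extNS →ₗ[ℤ] Λ :=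
  LinearMap.fst ℤ Λ ℤ ∘ₗ LinearMap.snd ℤ ℤ (Λ × ℤ) ∘ₗ X.extNS.subtype

/-- The component `N(X) → H⁴(X, ℤ)`. -/
def degFour : X.extNS →ₗ[ℤ] ℤ :=
  LinearMap.snd ℤ Λ ℤ ∘ₗ LinearMap.snd ℤ ℤ (Λ × ℤ) ∘ₗ X.extNS.subtype

/-- The real-linear extension of an integral linear form. -/
def realFunctional {N : Type u} [AddCommGroup N] (f : N →ₗ[ℤ] ℤ) : ℝ ⊗[ℤ] N →ₗ[ℝ] ℝ :=
  (TensorProduct.AlgebraTensorModule.rid ℤ ℝ ℝ).toLinearMap ∘ₗ LinearMap.baseChange ℝ f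

theorem realFunctional_tmul {N : Type u} [AddCommGroup N] (f : N →ₗ[ℤ] ℤ) (t : ℝ) (n : N) :
    realFunctional f (t ⊗ₜ n) = t * f n := by
  simp [realFunctional, mul_comm]

theorem realForm_extForm (u w : ℝ ⊗[ℤ] X.extNS) : realForm X.extForm u w =
    realForm X.form (LinearMap.baseChange ℝ X.degTwo u) (LinearMap.baseChange ℝ X.degTwo w)
      - realFunctional X.degZero u * realFunctional X.degFour w
      - realFunctional X.degZero w * realFunctional X.degFour u := by
  induction u using TensorProduct.induction_on with
  | zero => simp
  | add u u' hu hu' => simp only [map_add, LinearMap.add_apply, hu, hu']; ring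
  | tmul s m =>
    induction w using TensorProduct.induction_on with
    | zero => simp
    | add w w' hw hw' => simp only [map_add, hw, hw']; ring
    | tmul t n =>
      simp only [realFunctional_tmul, LinearMap.baseChange_tmul, realForm,
        LinearMap.BilinForm.baseChange_tmul]
      simp [extForm, mukaiForm, degZero, degTwo, degFour]
      ring

/-- Classes in NS(X) are real, so being orthogonal to σ means being orthogonal to its real and
imaginary parts separately. -/
theorem realForm_degTwo_period (u : ℝ ⊗[ℤ] X.extNS) :
    realForm X.form (LinearMap.baseChange ℝ X.degTwo u) (rePart X.σ) = 0 ∧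
      realForm X.form (LinearMap.baseChange ℝ X.degTwo u) (imPart X.σ) = 0 := by
  induction u using TensorProduct.induction_on with
  | zero => simp
  | add u u' hu hu' => simp [hu, hu']
  | tmul s m =>
    have h1 : cform (realForm X.form) ((1 : ℂ) ⊗ₜ[ℝ] toReal (X.degTwo m)) X.σ = 0 := m.2.2.1
    have h2 : (1 : ℂ) ⊗ₜ[ℝ] toReal (X.degTwo m) = ofReIm (toReal (X.degTwo m)) 0 := by
      simp [ofReIm]
    rw [h2, ← ofReIm_rePart_imPart X.σ, cform_ofReIm] at h1
    simp [Complex.ext_iff] at h1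
    have h3 : s ⊗ₜ[ℤ] X.degTwo m = s • toReal (X.degTwo m) := by
      simp [toReal, TensorProduct.smul_tmul']
    rw [LinearMap.baseChange_tmul, h3]
    simp [h1]

theorem realForm_extForm_isSymm : (realForm X.extForm).IsSymm := by
  refine ⟨fun u w => ?_⟩
  rw [realForm_extForm, realForm_extForm, X.signature.1.eq]
  ring

/-- A positive 3-space in N(X)_ℝ meets the hyperplane of degree-zero component 0 in dimension at
least 2. There the Mukai norm equals the norm of the H²-component, which is orthogonal to σ; adding
Re σ and Im σ would give a positive 4-space in H², of signature (3, 19). -/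
theorem realForm_extForm_atMostTwoPositive : AtMostTwoPositive (realForm X.extForm) := by
  intro a b c hab hac hbc ha hb
  by_contra! hc
  obtain ⟨h1, h2, h3⟩ := (mem_periodCone_iff X.signature.1).mp X.σ_mem
  have hs : ∀ x y, realForm X.extForm x y = 0 → realForm X.extForm y x = 0 :=
    fun x y h => (X.realForm_extForm_isSymm.eq y x).trans h
  have hF : ∀ x y, realForm X.form x y = realForm X.form y x :=
    fun x y => X.signature.1.eq x y
  set Ψ : (Fin 3 → ℝ) →ₗ[ℝ] ℝ ⊗[ℤ] X.extNS := Fintype.linearCombination ℝ ![a, b, c]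
  have hΨ : ∀ e, realForm X.extForm (Ψ e) (Ψ e) = e 0 ^ 2 * realForm X.extForm a a +
      e 1 ^ 2 * realForm X.extForm b b + e 2 ^ 2 * realForm X.extForm c c := fun e => by
    simp only [Ψ, Fintype.linearCombination_apply, Fin.sum_univ_three, map_add, map_smul,
      LinearMap.add_apply, LinearMap.smul_apply, smul_eq_mul, Matrix.cons_val_zero,
      Matrix.cons_val_one, Matrix.cons_val, hab, hac, hbc, hs _ _ hab, hs _ _ hac, hs _ _ hbc]
    ring
  set f : (Fin 3 → ℝ) →ₗ[ℝ] ℝ := realFunctional X.degZero ∘ₗ Ψ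
  have hker : 2 ≤ Module.finrank ℝ (LinearMap.ker f) := by
    have e1 := f.finrank_range_add_finrank_ker
    have e2 := Submodule.finrank_le (LinearMap.range f)
    simp only [Module.finrank_fin_fun, Module.finrank_self] at e1 e2
    omega
  have hle := X.signature.finrank_le (E := LinearMap.ker f × (ℝ × ℝ))
    (LinearMap.coprod (LinearMap.baseChange ℝ X.degTwo ∘ₗ Ψ ∘ₗ (LinearMap.ker f).subtype)
      (LinearMap.coprod (LinearMap.toSpanSingleton ℝ _ (rePart X.σ))
        (LinearMap.toSpanSingleton ℝ _ (imPart X.σ)))) (by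
      rintro ⟨⟨e, he⟩, s, t⟩ hne
      obtain ⟨h4, h5⟩ := X.realForm_degTwo_period (Ψ e)
      have h6 := X.realForm_extForm (Ψ e) (Ψ e)
      have he' : realFunctional X.degZero (Ψ e) = 0 := he
      rw [hΨ, he', zero_mul, sub_zero, sub_zero] at h6
      simp only [LinearMap.coprod_apply, LinearMap.comp_apply, Submodule.subtype_apply,
        LinearMap.toSpanSingleton_apply, map_add, map_smul, LinearMap.add_apply,
        LinearMap.smul_apply, smul_eq_mul, hF (rePart X.σ) (LinearMap.baseChange ℝ X.degTwo (Ψ e)),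
        hF (imPart X.σ) (LinearMap.baseChange ℝ X.degTwo (Ψ e)), hF (imPart X.σ) (rePart X.σ),
        h4, h5, h1, h2]
      rw [← h6]
      by_contra hle
      apply hne
      have p0 := mul_nonneg (sq_nonneg (e 0)) ha.le
      have p1 := mul_nonneg (sq_nonneg (e 1)) hb.le
      have p2 := mul_nonneg (sq_nonneg (e 2)) hc.le
      have p3 := mul_nonneg (sq_nonneg s) h3.le
      have p4 := mul_nonneg (sq_nonneg t) h3.le
      have q : ∀ x y : ℝ, 0 < y → x ^ 2 * y ≤ 0 → x = 0 := fun x y hy hxy => by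
        by_contra hx
        exact absurd (mul_pos (by positivity) hy) (not_lt.mpr hxy)
      have z0 := q (e 0) _ ha (by linarith)
      have z1 := q (e 1) _ hb (by linarith)
      have z2 := q (e 2) _ hc (by linarith)
      have z3 := q s _ h3 (by linarith)
      have z4 := q t _ h3 (by linarith)
      have ze : e = 0 := by ext i; fin_cases i <;> assumption
      simp [ze, z3, z4])
  rw [Module.finrank_prod, Module.finrank_prod, Module.finrank_self] at hle
  omega

/-- By flatness of ℝ over ℤ, N(X)_ℝ embeds into the real Mukai space, where a vector is the sum of
its three components. -/
theorem eq_zero_of_components {u : ℝ ⊗[ℤ] X.extNS} (h0 : realFunctional X.degZero u = 0)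
    (h2 : LinearMap.baseChange ℝ X.degTwo u = 0) (h4 : realFunctional X.degFour u = 0) :
    u = 0 := by
  have hinj : Function.Injective (LinearMap.lTensor ℝ X.extNS.subtype) :=
    Module.Flat.lTensor_preserves_injective_linearMap _ X.extNS.injective_subtype
  apply hinj
  have h0' : LinearMap.lTensor ℝ X.degZero u = 0 :=
    (TensorProduct.AlgebraTensorModule.rid ℤ ℝ ℝ).injective (by rw [map_zero]; exact h0)
  have h2' : LinearMap.lTensor ℝ X.degTwo u = 0 := h2
  have h4' : LinearMap.lTensor ℝ X.degFour u = 0 :=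
    (TensorProduct.AlgebraTensorModule.rid ℤ ℝ ℝ).injective (by rw [map_zero]; exact h4)
  have hsum : X.extNS.subtype = LinearMap.inl ℤ ℤ (Λ × ℤ) ∘ₗ X.degZero +
      (LinearMap.inr ℤ ℤ (Λ × ℤ) ∘ₗ LinearMap.inl ℤ Λ ℤ) ∘ₗ X.degTwo +
      (LinearMap.inr ℤ ℤ (Λ × ℤ) ∘ₗ LinearMap.inr ℤ Λ ℤ) ∘ₗ X.degFour := by
    ext n <;> simp [degZero, degTwo, degFour]
  rw [map_zero, hsum, LinearMap.lTensor_add, LinearMap.lTensor_add, LinearMap.lTensor_comp,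
    LinearMap.lTensor_comp _ _ X.degTwo, LinearMap.lTensor_comp _ _ X.degFour]
  simp [h0', h2', h4']

theorem realForm_extForm_nondegenerate : (realForm X.extForm).Nondegenerate := by
  refine X.realForm_extForm_isSymm.isRefl.nondegenerate_iff_separatingLeft.mpr ?_
  intro w hw
  obtain ⟨h1, h2, h3⟩ := (mem_periodCone_iff X.signature.1).mp X.σ_mem
  have hF : ∀ x y, realForm X.form x y = realForm X.form y x := fun x y => X.signature.1.eq x y
  have h0 : realFunctional X.degZero w = 0 := by
    have := hw (toReal X.v₀)
    rw [realForm_extForm] at this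
    simpa [toReal, realFunctional_tmul, degZero, degTwo, degFour, v₀] using this
  have h4 : realFunctional X.degFour w = 0 := by
    have := hw (toReal X.e₀)
    rw [realForm_extForm] at this
    simpa [toReal, realFunctional_tmul, degZero, degTwo, degFour, e₀] using this
  have hh : realForm X.form (LinearMap.baseChange ℝ X.degTwo w) (toReal X.h) = 0 := by
    have := hw (toReal X.h₀)
    rw [realForm_extForm] at this
    simpa [toReal, realFunctional_tmul, degZero, degTwo, degFour, h₀] using this
  have hww := hw w
  rw [realForm_extForm, h0, zero_mul, sub_zero, sub_zero] at hww
  obtain ⟨h5, h6⟩ := X.realForm_degTwo_period w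
  have h7 : LinearMap.baseChange ℝ X.degTwo (toReal X.h₀) = toReal X.h := by
    simp [toReal, degTwo, h₀]
  obtain ⟨h8, h9⟩ := X.realForm_degTwo_period (toReal X.h₀)
  rw [h7] at h8 h9
  have hhh : 0 < realForm X.form (toReal X.h) (toReal X.h) := by
    rw [realForm_toReal]
    exact_mod_cast X.h_pos
  -- The H²-component of a radical vector is isotropic and orthogonal to Re σ, Im σ and h. These are
  -- three orthogonal positive vectors, the maximal number in signature (3, 19), so it vanishes.
  refine X.eq_zero_of_components h0 (X.signature.eq_zero_of_isotropic
    ![rePart X.σ, imPart X.σ, toReal X.h] ?_ ?_ hww ?_) h4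
  · intro i j hij
    fin_cases i <;> fin_cases j <;> first | exact absurd rfl hij | skip
    exacts [h1, (hF _ _).trans h8, (hF _ _).trans h1, (hF _ _).trans h9, h8, h9]
  · intro i
    fin_cases i
    exacts [h3, h3.trans_eq h2.symm, hhh]
  · intro i
    fin_cases i
    exacts [h5, h6, hh]

end K3Data

end KahlerPeriod

end

theorem mainTheorem12 :
    -- linear paths in the tube domain are geodesics of constant (positive) speed
    (∀ (N : Type u) [AddCommGroup N] [Module.Free ℤ N] [Module.Finite ℤ N]
      (b : LinearMap.BilinForm ℤ N) (ρ : ℕ), KahlerPeriod.HasSignature (KahlerPeriod.realForm b) 2 ρ →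
      ∀ v : N, KahlerPeriod.IsPrimitiveIsotropic b v →
      ∀ τ : KahlerPeriod.TubeDomain (KahlerPeriod.realForm b) (KahlerPeriod.toReal v),
        ∃ k : ℝ, 0 < k ∧ KahlerPeriod.IsGeodesicOn (KahlerPeriod.realForm b)
          (fun t => KahlerPeriod.tubeExp (τ.scale (Real.exp t) (Real.exp_pos t))) Set.univ k) ∧
    -- linear degenerations in a quotient `Γ \ 𝒟⁺`, parametrized by `log t`, are geodesics
    (∀ (N : Type u) [AddCommGroup N] [Module.Free ℤ N] [Module.Finite ℤ N]
      (b : LinearMap.BilinForm ℤ N) (ρ : ℕ), KahlerPeriod.HasSignature (KahlerPeriod.realForm b) 2 ρ →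
      ∀ p₀ ∈ KahlerPeriod.periodDomain (KahlerPeriod.realForm b),
      ∀ Γ ≤ KahlerPeriod.isometriesPlus b p₀,
      ∀ v : N, KahlerPeriod.IsStandard b v →
      ∀ γ : ℝ → KahlerPeriod.PeriodQuotient b p₀ Γ, KahlerPeriod.IsLinearDegeneration γ v →
        ∃ k : ℝ, 0 < k ∧ ∃ T : ℝ,
          KahlerPeriod.IsQuotientGeodesicOn (fun t => γ (Real.exp t)) (Set.Ioi T) k) ∧
    -- in particular in the Kähler moduli space of a projective K3 surface
    (∀ (Λ : Type u) [AddCommGroup Λ] [Module.Free ℤ Λ] [Module.Finite ℤ Λ]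
      (X : KahlerPeriod.K3Data Λ), ∀ v : X.extNS, KahlerPeriod.IsStandard X.extForm v →
      ∀ γ : ℝ → X.KM, KahlerPeriod.IsLinearDegeneration γ v →
        ∃ k : ℝ, 0 < k ∧ ∃ T : ℝ,
          KahlerPeriod.IsQuotientGeodesicOn (fun t => γ (Real.exp t)) (Set.Ioi T) k) := by
  refine ⟨?_, ?_, ?_⟩
  · intro N _ _ _ b ρ hb v _ τ
    exact ⟨_, KahlerPeriod.isGeodesicOn_tubeExp hb.1 hb.2.1 hb.atMostTwoPositive τ Set.univ⟩
  · intro N _ _ _ b ρ hb p₀ _ Γ _ v _ γ hγ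
    exact hγ.isQuotientGeodesicOn hb.1 hb.2.1 hb.atMostTwoPositive
  -- The exact signature of N(X) need not be computed: the three properties of its form established
  -- above suffice.
  · intro Λ _ _ _ X v _ γ hγ
    exact hγ.isQuotientGeodesicOn X.realForm_extForm_isSymm X.realForm_extForm_nondegenerate
      X.realForm_extForm_atMostTwoPositive
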